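/- Let $n\ge 0$. For $0\le k\le n$ let $E_k$ be a measurable space, $\eta_0$ a probability measure on $E_0$, and for $1\le k\le n$ let $M_k$ be a Markov kernel from $E_{k-1}$ to $E_k$ of the form $M_k(x,dy)=H_k(x,y)\,\lambda_k(dy)$ with a measure $\lambda_k$ on $E_k$ and a jointly measurable function $H_k>0$. Let $G_k:E_k\to(0,\infty)$ ($0\le k<n$) and $f_k:E_k\to\mathbb R$ ($0\le k\le n$) be measurable. Put $$Q_{k+1}(g)(x)=G_k(x)\int g(y)\,M_{k+1}(x,dy),\qquad Q_{k,l}=Q_{k+1}\cdots Q_l,\qquad Q_{k,k}=\mathrm{Id},$$ and assume $Q_{k,l}(|f_l|)(x)<\infty$ for all $k\le l\le n$ and $x\in E_k$. The Snell envelope is defined by $v_n=f_n$ and $v_k=\max\big(f_k,\,Q_{k+1}(v_{k+1})\big)$ for $0\le k<n$. Let $N\ge 1$ and let $\varepsilon\ge 0$ be such that $\varepsilon G_k\le 1$ for all $k<n$. The particle model $\xi_k=(\xi_k^i)_{1\le i\le N}$, $0\le k\le n$, is the Markov chain for which $\xi_0^1,\dots,\xi_0^N$ are i.i.d. with law $\eta_0$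 and, given $\xi_0,\dots,\xi_k$, the particles $\xi_{k+1}^i$ are independent, $\xi_{k+1}^i$ having law $M_{k+1}(\widehat\xi_k^i,\cdot)$, where $\widehat\xi_k^i=\xi_k^i$ with probability $\varepsilon G_k(\xi_k^i)$ and otherwise $\widehat\xi_k^i=\xi_k^j$ with probability $G_k(\xi_k^j)/\sum_{m}G_k(\xi_k^m)$. Write $\eta_k^N(g)=\frac1N\sum_{i}g(\xi_k^i)$. The estimator is $\widehat v_n=f_n$ and, for $0\le k<n$ and $x\in E_k$, $$\widehat v_k(x)=\max\left(f_k(x),\ \frac1N\sum_{i=1}^N \frac{G_k(x)\,H_{k+1}(x,\xi_{k+1}^i)\,\eta_k^N(G_k)}{\eta_k^N\big(G_kH_{k+1}(\cdot,\xi_{k+1}^i)\big)}\ \widehat v_{k+1}(\xi_{k+1}^i)\right).$$ Let $h_k(y)=\sup_{x,x'\in E_{k-1}}H_k(x,y)/H_k(x',y)\in[1,\infty]$ for $1\le k\le n$, assumed measurable up to $\lambda_k$-null sets. Let $\|\cdot\|$ be the supremum norm, with values in $[0,\infty]$. For integers $m\ge 0$ (with $m\geq 1$ in the first formula) put $$a(2m)^{2m}=\frac{(2m)!}{m!}\,2^{-m},\qquad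 a(2m+1)^{2m+1}=\frac{(2m+1)!/m!}{\sqrt{m+1/2}}\,2^{-(m+1/2)}.$$ Then for all $0\le k\le n$, every integer $p\ge1$, every even integer $p'\ge p$ (in particular the smallest even integer greater than $p$) and every $x\in E_k$, $$\big\|\widehat v_k(x)-v_k(x)\big\|_{L_p}\ \le\ \sum_{k\le l<n}\frac{2a(p)}{\sqrt N}\,q_{k,l}\,\Big[Q_{k,l+1}\big(h_{l+1}^{p'-1}v_{l+1}^{p'}\big)(x)\Big]^{1/p'},\qquad q_{k,l}=\Big[\|G_l\|\,\|h_{k+1}\|\prod_{m=k}^{l-1}\|G_m\|\Big]^{(p'-1)/p'},$$ and consequently the supremum over $x\in E_k$ of the left-hand side is at most the supremum over $x\in E_k$ of the right-hand side (both sides with values in $[0,\infty]$, with the convention $0\cdot\infty=0$). -/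

import Mathlib

open MeasureTheory ProbabilityTheory
open scoped ENNReal

noncomputable section

/-! Throughout, `E k` is the state space at time `k`, `M k` is the Markov transition from `E k` to
`E (k + 1)` (written `M_{k+1}` on paper), `H k x y` is the density of `M k x` at `y` with respect
to a reference measure on `E (k + 1)` (written `H_{k+1}(x, y)`), `f k` are the gain functions and
`G k` the potential functions. -/

/-- `snellSteps f G M j k` is the Snell envelope at time `k` when `j` steps remain before the
horizon. -/
def snellSteps {E : ℕ → Type*} [∀ k, MeasurableSpace (E k)] (f G : ∀ k, E k → ℝ)
    (M : ∀ k, Kernel (E k) (E (k + 1))) : ℕ → ∀ k, E k → ℝ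
  | 0, k, x => f k x
  | j + 1, k, x => max (f k x) (G k x * ∫ y, snellSteps f G M j (k + 1) y ∂(M k x))

/-- The Snell envelope with horizon `n`: `v_n = f_n` and
`v_k = f_k ∨ (G_k M_{k+1}(v_{k+1}))` for `k < n`. -/
def snell {E : ℕ → Type*} [∀ k, MeasurableSpace (E k)] (f G : ∀ k, E k → ℝ)
    (M : ∀ k, Kernel (E k) (E (k + 1))) (n k : ℕ) : E k → ℝ :=
  snellSteps f G M (n - k) k

/-- The integral `η^N(g)` of `g` against the empirical measure `η^N = N⁻¹ ∑ i, δ_{z i}`. -/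
def empMean {N : ℕ} {α : Type*} (z : Fin N → α) (g : α → ℝ) : ℝ :=
  (∑ i, g (z i)) / N

/-- The Radon-Nikodym derivative `dQ_{k+1}(x, ·) / dΦ_{k+1}(η^N)` at `y`, where
`η^N` is the empirical measure of `z : Fin N → E k`, in its everywhere defined version
`G_k(x) H_{k+1}(x, y) η^N(G_k) / η^N(G_k H_{k+1}(·, y))`. -/
def meshWeight {E : ℕ → Type*} (G : ∀ k, E k → ℝ) (H : ∀ k, E k → E (k + 1) → ℝ) {N : ℕ}
    (k : ℕ) (z : Fin N → E k) (x : E k) (y : E (k + 1)) : ℝ :=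
  G k x * H k x y * empMean z (G k) / empMean z (fun w => G k w * H k w y)

/-- The particle approximation of the Snell envelope at time `k` when `j` steps remain, computed
from the particles `z m : Fin N → E m`. -/
def snellHatSteps {E : ℕ → Type*} (f G : ∀ k, E k → ℝ) (H : ∀ k, E k → E (k + 1) → ℝ) {N : ℕ}
    (z : ∀ m, Fin N → E m) : ℕ → ∀ k, E k → ℝ
  | 0, k, x => f k x
  | j + 1, k, x => max (f k x)
      (empMean (z (k + 1))
        (fun y => meshWeight G H k (z k) x y * snellHatSteps f G H z j (k + 1) y))

/-- The particle estimator with horizon `n`: `v̂_n = f_n` and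
`v̂_k(x) = f_k(x) ∨ η^N_{k+1}((dQ_{k+1}(x, ·)/dΦ_{k+1}(η^N_k)) v̂_{k+1})` for `k < n`. -/
def snellHat {E : ℕ → Type*} (f G : ∀ k, E k → ℝ) (H : ∀ k, E k → E (k + 1) → ℝ) {N : ℕ}
    (z : ∀ m, Fin N → E m) (n k : ℕ) : E k → ℝ :=
  snellHatSteps f G H z (n - k) k

/-- Law of the `i`-th selected particle given the particles `z`: with probability `ε G(z i)` it
stays at `z i`, otherwise it jumps to `z j` with probability `G(z j) / ∑ l, G(z l)`. -/
def selectionLaw {N : ℕ} {α : Type*} [MeasurableSpace α] (ε : ℝ) (G : α → ℝ) (z : Fin N → α)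
    (i : Fin N) : Measure α :=
  ENNReal.ofReal (ε * G (z i)) • Measure.dirac (z i) +
    ENNReal.ofReal (1 - ε * G (z i)) •
      ∑ j, ENNReal.ofReal (G (z j) / ∑ l, G (z l)) • Measure.dirac (z j)

/-- One step of the particle model from the configuration `z`: the particles are selected and then
mutated by `M`, independently of one another. -/
def particleStep {N : ℕ} {α β : Type*} [MeasurableSpace α] [MeasurableSpace β] (ε : ℝ)
    (G : α → ℝ) (M : Kernel α β) (z : Fin N → α) : Measure (Fin N → β) :=
  Measure.pi (fun i => (selectionLaw ε G z i).bind M)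

/-- `ξ` is, up to time `n`, the particle model with `N` particles: a Markov chain with
`ξ 0` made of `N` independent variables of law `η₀`, and such that, given the sigma-field
generated by `ξ 0, …, ξ k`, the conditional law of `ξ (k + 1)` is `particleStep` from `ξ k`. -/
structure IsParticleModel {E : ℕ → Type*} [∀ k, MeasurableSpace (E k)] {N : ℕ}
    {Ω : Type*} [MeasurableSpace Ω] (η₀ : Measure (E 0)) (M : ∀ k, Kernel (E k) (E (k + 1)))
    (G : ∀ k, E k → ℝ) (ε : ℝ) (n : ℕ) (P : Measure Ω) (ξ : ∀ k, Ω → Fin N → E k) : Prop where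
  measurable : ∀ k ≤ n, Measurable (ξ k)
  init : P.map (ξ 0) = Measure.pi (fun _ => η₀)
  step : ∀ k < n, ∀ A : Set Ω,
    MeasurableSet[⨆ j ≤ k, MeasurableSpace.comap (ξ j) inferInstance] A →
    ∀ B : Set (Fin N → E (k + 1)), MeasurableSet B →
      P (A ∩ ξ (k + 1) ⁻¹' B) = ∫⁻ ω in A, particleStep ε (G k) (M k) (ξ k ω) B ∂P

/-- The iterates of the operators `Q_{k+1}(g)(x) = G_k(x) ∫ g(y) M_{k+1}(x, dy)`, on functions with
values in `[0, ∞]`: `QSteps G M g j k = Q_{k+1} ⋯ Q_{k+j} (g_{k+j})`. -/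
def QSteps {E : ℕ → Type*} [∀ k, MeasurableSpace (E k)] (G : ∀ k, E k → ℝ)
    (M : ∀ k, Kernel (E k) (E (k + 1))) (g : ∀ k, E k → ℝ≥0∞) : ℕ → ∀ k, E k → ℝ≥0∞
  | 0, k, x => g k x
  | j + 1, k, x => ENNReal.ofReal (G k x) * ∫⁻ y, QSteps G M g j (k + 1) y ∂(M k x)

/-- `Qop G M k l g = Q_{k,l}(g_l)`, a function on `E k`, for `k ≤ l`, where
`Q_{k,l} = Q_{k+1} ⋯ Q_l`. Only the member `g l` of the family `g` matters. -/
def Qop {E : ℕ → Type*} [∀ k, MeasurableSpace (E k)] (G : ∀ k, E k → ℝ)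
    (M : ∀ k, Kernel (E k) (E (k + 1))) (k l : ℕ) (g : ∀ k, E k → ℝ≥0∞) : E k → ℝ≥0∞ :=
  QSteps G M g (l - k) k

/-- `h_k(y) = sup_{x, x'} H_k(x, y) / H_k(x', y)` for `k ≥ 1`, with values in `[0, ∞]`.
There is no `h_0`; the value at `k = 0` is never used. -/
def hRatio {E : ℕ → Type*} (H : ∀ k, E k → E (k + 1) → ℝ) : ∀ k, E k → ℝ≥0∞
  | 0, _ => 1
  | k + 1, y => ⨆ (x : E k) (x' : E k), ENNReal.ofReal (H k x y / H k x' y)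

/-- The supremum norm of `G_k`. -/
def supNormG {E : ℕ → Type*} (G : ∀ k, E k → ℝ) (k : ℕ) : ℝ≥0∞ :=
  ⨆ x : E k, ENNReal.ofReal |G k x|

/-- The supremum norm of `h_k`. -/
def supNormH {E : ℕ → Type*} (H : ∀ k, E k → E (k + 1) → ℝ) (k : ℕ) : ℝ≥0∞ :=
  ⨆ y : E k, hRatio H k y

/-- `q_{k,l} = [‖G_l‖ ‖h_{k+1}‖ ∏_{m=k}^{l-1} ‖G_m‖]^{(p' - 1) / p'}`. -/
def qConst {E : ℕ → Type*} (G : ∀ k, E k → ℝ) (H : ∀ k, E k → E (k + 1) → ℝ) (p' k l : ℕ) :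
    ℝ≥0∞ :=
  (supNormG G l * supNormH H (k + 1) * ∏ m ∈ Finset.Ico k l, supNormG G m) ^
    (((p' : ℝ) - 1) / p')

/-- The constants `a(p)`: with `(q)_m = q! / (q - m)!`,
`a(2m)^{2m} = (2m)_m 2^{-m}` and
`a(2m+1)^{2m+1} = (2m+1)_{m+1} / √(m + 1/2) * 2^{-(m+1/2)}`. Here `m = p / 2`. -/
def aConst (p : ℕ) : ℝ :=
  (if Even p then (p.descFactorial (p / 2) : ℝ) * (2 : ℝ) ^ (-((p / 2 : ℕ) : ℝ))
    else (p.descFactorial (p / 2 + 1) : ℝ) / Real.sqrt (((p / 2 : ℕ) : ℝ) + 1 / 2) *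
      (2 : ℝ) ^ (-(((p / 2 : ℕ) : ℝ) + 1 / 2))) ^ (1 / (p : ℝ))

/-- The right-hand side of the error bound at the point `x ∈ E k`:
`∑_{k ≤ l < n} (2 a(p) / √N) q_{k,l} [Q_{k,l+1}(h_{l+1}^{p'-1} v_{l+1}^{p'})(x)]^{1/p'}`. -/
def errorBound {E : ℕ → Type*} [∀ k, MeasurableSpace (E k)] (f G : ∀ k, E k → ℝ)
    (M : ∀ k, Kernel (E k) (E (k + 1))) (H : ∀ k, E k → E (k + 1) → ℝ) (n N p p' k : ℕ)
    (x : E k) : ℝ≥0∞ :=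
  ∑ l ∈ Finset.Ico k n, ENNReal.ofReal (2 * aConst p / Real.sqrt N) * qConst G H p' k l *
    (Qop G M k (l + 1)
      (fun m y => hRatio H m y ^ (p' - 1) * ENNReal.ofReal (snell f G M n m y ^ p')) x) ^
        (1 / (p' : ℝ))

end

/-! Write `Q̂_{l+1}` for the empirical operator built from the particles at times `l` and `l + 1`.
Since `max (f, ·)` is 1-Lipschitz and `Q̂` is positive, `|v̂_l - v_l| ≤ |(Q̂_{l+1} - Q_{l+1})
v_{l+1}| + Q̂_{l+1} |v̂_{l+1} - v_{l+1}|`. Iterating up to the horizon, where the error vanishes,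
bounds the error at `x` by the sum over `l` of `Q̂_{k,l} |(Q̂_{l+1} - Q_{l+1}) v_{l+1}| (x)`, and
Minkowski's inequality treats the terms separately.

For a fixed `l`, the measure `Q̂_{k,l}(x, ·)` is a sum of point masses with nonnegative weights
(`pathWeight`) that are known at time `l`. Three facts carry the estimate.

(1) Given the past, the particles at time `l + 1` are independent with laws that need not agree, but
the weighted average is unbiased for `Q_{l+1}` (`sum_lintegral_meshWeight_mul`). Symmetrization and
Khintchine's inequality give the factor `2 a(p) / √N` and a moment of order `p'` of weight times `v`
(`lintegral_particleStep_fluctuation_le`). One factor of the weight is absorbed by unbiasedness; the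
other `p' - 1` are at most `‖G_l‖ h_{l+1}` each.

(2) The total mass of the path weights is at most `‖h_{k+1}‖ ∏ ‖G_m‖`
(`IsDensityModel.sum_ofReal_pathWeight_le`). Only the first step costs a density ratio: later the
starting points are the particles themselves, over which the weights average to `η^N(G)`.

(3) The path weights are unbiased, so the expectation of `Q̂_{k,l} g (x)` is `Q_{k,l} g (x)`
(`IsDensityModel.lintegral_sum_pathWeight`).

Jensen's inequality, applied to the weighted sums and to the expectation, combines the three. -/

/-! ### Khintchine's inequality -/

/-- The sum of the `x i`, `i ∈ s`, with the signs of the terms indexed by `T` reversed. -/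
def signSum {ι : Type*} [DecidableEq ι] (T s : Finset ι) (x : ι → ℝ) : ℝ :=
  ∑ i ∈ s, if i ∈ T then -x i else x i

/-- The moment of order `2 m` of a standard Gaussian variable. -/
noncomputable def evenMoment (m : ℕ) : ℝ :=
  ((2 * m).factorial : ℝ) / (m.factorial * 2 ^ m)

theorem evenMoment_pos (m : ℕ) : 0 < evenMoment m := by
  unfold evenMoment; positivity

theorem sum_range_two_mul_add_one (h : ℕ → ℝ) (m : ℕ) :
    ∑ i ∈ Finset.range (2 * m + 1), h i =
      ∑ j ∈ Finset.range (m + 1), h (2 * j) + ∑ j ∈ Finset.range m, h (2 * j + 1) := by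
  induction m with
  | zero => simp
  | succ m ih =>
    rw [show 2 * (m + 1) + 1 = 2 * m + 1 + 1 + 1 by ring, Finset.sum_range_succ,
      Finset.sum_range_succ, ih, Finset.sum_range_succ _ (m + 1),
      Finset.sum_range_succ (fun j => h (2 * j + 1)) m, show 2 * (m + 1) = 2 * m + 1 + 1 by ring]
    ring

theorem add_pow_two_mul_add_sub_pow (x S : ℝ) (m : ℕ) :
    (x + S) ^ (2 * m) + (-x + S) ^ (2 * m) =
      2 * ∑ j ∈ Finset.range (m + 1),
        ((2 * m).choose (2 * j) : ℝ) * x ^ (2 * j) * S ^ (2 * (m - j)) := by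
  rw [add_pow, add_pow, sum_range_two_mul_add_one, sum_range_two_mul_add_one]
  have h1 : ∑ j ∈ Finset.range m, (-x) ^ (2 * j + 1) * S ^ (2 * m - (2 * j + 1)) *
        ((2 * m).choose (2 * j + 1) : ℝ) =
      -∑ j ∈ Finset.range m, x ^ (2 * j + 1) * S ^ (2 * m - (2 * j + 1)) *
        ((2 * m).choose (2 * j + 1) : ℝ) := by
    rw [← Finset.sum_neg_distrib]
    refine Finset.sum_congr rfl fun j _ => ?_
    rw [Odd.neg_pow ⟨j, rfl⟩]; ring
  rw [h1, Finset.mul_sum, add_add_add_comm, add_neg_cancel, add_zero, ← Finset.sum_add_distrib]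
  refine Finset.sum_congr rfl fun j _ => ?_
  rw [Even.neg_pow ⟨j, two_mul j⟩, ← Nat.mul_sub]; ring

/-- After cancelling factorials this is `2 ^ j * j! ≤ (2 * j)!`. -/
theorem choose_mul_evenMoment_le {m j : ℕ} (hj : j ≤ m) :
    ((2 * m).choose (2 * j) : ℝ) * evenMoment (m - j) ≤ evenMoment m * (m.choose j : ℝ) := by
  obtain ⟨i, rfl⟩ := Nat.exists_eq_add_of_le hj
  have e1 := Nat.add_choose_mul_factorial_mul_factorial (2 * i) (2 * j)
  have e2 := Nat.add_choose_mul_factorial_mul_factorial i j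
  have h : (2 : ℝ) ^ j * j.factorial ≤ (2 * j).factorial := by
    exact_mod_cast Nat.two_pow_mul_factorial_le_factorial_two_mul j
  have e1' : ((2 * (j + i)).choose (2 * j) : ℝ) =
      (2 * (j + i)).factorial / ((2 * j).factorial * (2 * i).factorial) := by
    rw [eq_div_iff (by positivity), ← mul_assoc, mul_add]
    rw [add_comm] at e1; exact_mod_cast (by linarith : _ = _)
  have e2' : ((j + i).choose j : ℝ) = (j + i).factorial / (j.factorial * i.factorial) := by
    rw [eq_div_iff (by positivity), ← mul_assoc]
    rw [add_comm] at e2; exact_mod_cast (by linarith : _ = _)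
  unfold evenMoment
  rw [e1', e2', Nat.add_sub_cancel_left]
  have l : ((2 * (j + i)).factorial : ℝ) / ((2 * j).factorial * (2 * i).factorial) *
      ((2 * i).factorial / (i.factorial * 2 ^ i)) =
      (2 * (j + i)).factorial / (i.factorial * 2 ^ i) / (2 * j).factorial := by
    field_simp
  have r : ((2 * (j + i)).factorial : ℝ) / ((j + i).factorial * 2 ^ (j + i)) *
      ((j + i).factorial / (j.factorial * i.factorial)) =
      (2 * (j + i)).factorial / (i.factorial * 2 ^ i) / (2 ^ j * j.factorial) := by
    rw [pow_add]; field_simp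
  rw [l, r]
  gcongr

/-- Induction on `s`: summing over both signs of the new term kills the odd powers in the binomial
expansion, and `choose_mul_evenMoment_le` turns the surviving coefficients into those of `(x a ^ 2 +
∑ x i ^ 2) ^ m`. -/
theorem sum_powerset_signSum_even_pow_le {ι : Type*} [DecidableEq ι] (x : ι → ℝ) (s : Finset ι)
    (m : ℕ) :
    ∑ T ∈ s.powerset, signSum T s x ^ (2 * m) ≤
      2 ^ s.card * (evenMoment m * (∑ i ∈ s, x i ^ 2) ^ m) := by
  induction s using Finset.induction_on generalizing m with
  | empty =>
    rcases m with _ | m <;> simp [signSum, evenMoment]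
  | insert a s ha ih =>
    have h1 : ∀ T ∈ s.powerset, signSum T (insert a s) x = x a + signSum T s x := by
      intro T hT
      have : a ∉ T := fun h => ha (Finset.mem_powerset.1 hT h)
      simp [signSum, Finset.sum_insert ha, this]
    have h2 : ∀ T ∈ s.powerset, signSum (insert a T) (insert a s) x = -x a + signSum T s x := by
      intro T _
      simp only [signSum, Finset.sum_insert ha, Finset.mem_insert_self, if_true]
      congr 1
      refine Finset.sum_congr rfl fun i hi => ?_
      have : i ≠ a := fun h => ha (h ▸ hi)
      simp [this]
    rw [Finset.sum_powerset_insert ha, ← Finset.sum_add_distrib, Finset.card_insert_of_notMem ha,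
      Finset.sum_insert ha]
    calc ∑ T ∈ s.powerset, (signSum T (insert a s) x ^ (2 * m) +
          signSum (insert a T) (insert a s) x ^ (2 * m))
        = ∑ j ∈ Finset.range (m + 1), 2 * (((2 * m).choose (2 * j) : ℝ) * x a ^ (2 * j) *
            ∑ T ∈ s.powerset, signSum T s x ^ (2 * (m - j))) := by
          simp_rw [Finset.mul_sum]
          rw [Finset.sum_comm]
          refine Finset.sum_congr rfl fun T hT => ?_
          rw [h1 T hT, h2 T hT, add_pow_two_mul_add_sub_pow, Finset.mul_sum]
      _ ≤ ∑ j ∈ Finset.range (m + 1), 2 * (((2 * m).choose (2 * j) : ℝ) * x a ^ (2 * j) *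
            (2 ^ s.card * (evenMoment (m - j) * (∑ i ∈ s, x i ^ 2) ^ (m - j)))) := by
          refine Finset.sum_le_sum fun j _ => ?_
          have : 0 ≤ x a ^ (2 * j) := by rw [pow_mul]; positivity
          gcongr
          exact ih _
      _ ≤ ∑ j ∈ Finset.range (m + 1), 2 ^ (s.card + 1) * (evenMoment m * (m.choose j : ℝ)) *
            (x a ^ (2 * j) * (∑ i ∈ s, x i ^ 2) ^ (m - j)) := by
          refine Finset.sum_le_sum fun j hj => ?_
          have h3 := choose_mul_evenMoment_le (Nat.lt_succ_iff.1 (Finset.mem_range.1 hj))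
          have : 0 ≤ x a ^ (2 * j) := by rw [pow_mul]; positivity
          have h4 : 0 ≤ (∑ i ∈ s, x i ^ 2) ^ (m - j) :=
            pow_nonneg (Finset.sum_nonneg fun i _ => sq_nonneg _) _
          calc _ = 2 ^ (s.card + 1) * (((2 * m).choose (2 * j) : ℝ) * evenMoment (m - j)) *
                (x a ^ (2 * j) * (∑ i ∈ s, x i ^ 2) ^ (m - j)) := by ring
            _ ≤ _ := by gcongr
      _ = 2 ^ (s.card + 1) * (evenMoment m * (x a ^ 2 + ∑ i ∈ s, x i ^ 2) ^ m) := by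
          rw [add_pow, Finset.mul_sum, Finset.mul_sum]
          refine Finset.sum_congr rfl fun j _ => ?_
          rw [pow_mul]; ring

theorem aConst_nonneg (p : ℕ) : 0 ≤ aConst p := by
  unfold aConst; split_ifs <;> positivity

theorem aConst_pow_two_mul {m : ℕ} (hm : m ≠ 0) : aConst (2 * m) ^ (2 * m) = evenMoment m := by
  have h : ((2 * m).descFactorial m : ℝ) * m.factorial = (2 * m).factorial := by
    have := Nat.factorial_mul_descFactorial (show m ≤ 2 * m by omega)
    rw [show 2 * m - m = m by omega] at this
    rw [mul_comm]; exact_mod_cast this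
  unfold aConst
  rw [if_pos (even_two_mul m), one_div, Real.rpow_inv_natCast_pow (by positivity) (by omega),
    Nat.mul_div_cancel_left m two_pos, Real.rpow_neg two_pos.le, Real.rpow_natCast, evenMoment,
    ← h]
  field_simp

/-- The odd constant comes from the geometric mean of two consecutive even Gaussian moments, which
is exactly what Cauchy–Schwarz produces. -/
theorem aConst_pow_two_mul_add_one_sq (m : ℕ) :
    (aConst (2 * m + 1) ^ (2 * m + 1)) ^ 2 = evenMoment m * evenMoment (m + 1) := by
  have h : ((2 * m + 1).descFactorial (m + 1) : ℝ) * m.factorial = (2 * m + 1).factorial := by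
    have := Nat.factorial_mul_descFactorial (show m + 1 ≤ 2 * m + 1 by omega)
    rw [show 2 * m + 1 - (m + 1) = m by omega] at this
    rw [mul_comm]; exact_mod_cast this
  have hd : (2 * m + 1) / 2 = m := by omega
  have hD : ((2 * m + 1).descFactorial (m + 1) : ℝ) =
      (2 * m + 1) * (2 * m).factorial / m.factorial := by
    rw [eq_div_iff (by positivity), h, Nat.factorial_succ]; push_cast; ring
  unfold aConst
  rw [if_neg (by simp), one_div ((2 * m + 1 : ℕ) : ℝ), Real.rpow_inv_natCast_pow (by positivity) (by omega), hd,
    mul_pow, div_pow, Real.sq_sqrt (by positivity), ← Real.rpow_natCast (_ ^ _),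
    ← Real.rpow_mul two_pos.le,
    show -((m : ℝ) + 1 / 2) * ((2 : ℕ) : ℝ) = -((2 * m + 1 : ℕ) : ℝ) by push_cast; ring,
    Real.rpow_neg two_pos.le, Real.rpow_natCast, hD, evenMoment, evenMoment,
    show 2 * (m + 1) = 2 * m + 1 + 1 by ring, Nat.factorial_succ (2 * m + 1),
    Nat.factorial_succ (2 * m), Nat.factorial_succ m]
  push_cast
  field_simp
  ring

/-- Khintchine's inequality with the constants `aConst`. -/
theorem sum_powerset_abs_signSum_pow_le {ι : Type*} [DecidableEq ι] (x : ι → ℝ) (s : Finset ι)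
    {p : ℕ} (hp : 1 ≤ p) :
    ∑ T ∈ s.powerset, |signSum T s x| ^ p ≤
      2 ^ s.card * (aConst p * Real.sqrt (∑ i ∈ s, x i ^ 2)) ^ p := by
  have hσ : 0 ≤ ∑ i ∈ s, x i ^ 2 := Finset.sum_nonneg fun i _ => sq_nonneg _
  set σ := ∑ i ∈ s, x i ^ 2 with hσd
  rcases Nat.even_or_odd' p with ⟨m, rfl | rfl⟩
  · rw [mul_pow, aConst_pow_two_mul (by omega), pow_mul (Real.sqrt σ), Real.sq_sqrt hσ]
    refine le_of_eq_of_le ?_ (sum_powerset_signSum_even_pow_le x s m)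
    exact Finset.sum_congr rfl fun T _ => Even.pow_abs ⟨m, two_mul m⟩ _
  · have ha := aConst_nonneg (2 * m + 1)
    refine le_of_sq_le_sq ?_ (by positivity)
    -- Cauchy–Schwarz along `2 * m + 1 = m + (m + 1)` reduces the odd moment to the even ones of
    -- orders `2 * m` and `2 * m + 2`.
    have cs := Finset.sum_mul_sq_le_sq_mul_sq s.powerset (fun T => |signSum T s x| ^ m)
      (fun T => |signSum T s x| ^ (m + 1))
    have e : ∀ (y : ℝ) (i : ℕ), (|y| ^ i) ^ 2 = y ^ (2 * i) := fun y i => by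
      rw [← pow_mul, mul_comm, Even.pow_abs ⟨i, two_mul i⟩]
    simp only [← pow_add, e] at cs
    rw [show m + (m + 1) = 2 * m + 1 by ring] at cs
    refine cs.trans ?_
    calc _ ≤ (2 ^ s.card * (evenMoment m * σ ^ m)) *
          (2 ^ s.card * (evenMoment (m + 1) * σ ^ (m + 1))) := by
          have := evenMoment_pos m
          gcongr
          · exact Finset.sum_nonneg fun T _ => by rw [pow_mul]; positivity
          · exact sum_powerset_signSum_even_pow_le x s m
          · exact sum_powerset_signSum_even_pow_le x s (m + 1)
      _ = _ := by
          rw [mul_pow (2 ^ s.card), mul_pow (aConst _), mul_pow (aConst _ ^ _),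
            aConst_pow_two_mul_add_one_sq, ← pow_mul (Real.sqrt σ), mul_comm (2 * m + 1) 2,
            pow_mul (Real.sqrt σ), Real.sq_sqrt hσ]
          ring

/-! ### Symmetrization -/

theorem lintegral_rpow_le_lintegral_rpow {α : Type*} [MeasurableSpace α] {μ : Measure α}
    [IsProbabilityMeasure μ] {g : α → ℝ≥0∞} (hg : Measurable g) {r : ℝ} (hr : 1 ≤ r) :
    (∫⁻ a, g a ∂μ) ^ r ≤ ∫⁻ a, g a ^ r ∂μ := by
  have h := eLpNorm_le_eLpNorm_of_exponent_le (μ := μ) (f := g) (p := 1) (q := ENNReal.ofReal r)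
    (by simpa using hr) hg.aestronglyMeasurable
  have hr0 : 0 < r := by linarith
  rw [eLpNorm_one_eq_lintegral_enorm, eLpNorm_eq_lintegral_rpow_enorm_toReal (by simpa using hr0)
    ENNReal.ofReal_ne_top, ENNReal.toReal_ofReal hr0.le] at h
  simp only [enorm_eq_self] at h
  calc _ ≤ ((∫⁻ a, g a ^ r ∂μ) ^ (1 / r)) ^ r := by gcongr
    _ = _ := by rw [← ENNReal.rpow_mul, one_div_mul_cancel hr0.ne', ENNReal.rpow_one]

theorem measurable_signSum {ι : Type*} [DecidableEq ι] (T s : Finset ι) {α : Type*}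
    [MeasurableSpace α] {x : ι → α → ℝ} (hx : ∀ i, Measurable (x i)) :
    Measurable fun a => signSum T s (fun i => x i a) := by
  refine Finset.measurable_fun_sum _ fun i _ => ?_
  split_ifs
  · exact (hx i).neg
  · exact hx i

/-- Convexity separates the two copies at the price `2 ^ (p - 1)`, and Khintchine applies to each.
Once both copies have the same law this becomes `2 ^ p`, the source of the 2 in `2 a(p)`. -/
theorem enorm_signSum_sub_pow_le {ι : Type*} [DecidableEq ι] (s : Finset ι) (x y : ι → ℝ) {p : ℕ}
    (hp : 1 ≤ p) :
    ∑ T ∈ s.powerset, ‖signSum T s (fun i => x i - y i)‖ₑ ^ p ≤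
      2 ^ s.card * (2 ^ (p - 1) *
        (ENNReal.ofReal ((aConst p * Real.sqrt (∑ i ∈ s, x i ^ 2)) ^ p) +
          ENNReal.ofReal ((aConst p * Real.sqrt (∑ i ∈ s, y i ^ 2)) ^ p))) := by
  have ha := aConst_nonneg p
  have h1 : ∀ T ∈ s.powerset, |signSum T s (fun i => x i - y i)| ^ p ≤
      2 ^ (p - 1) * (|signSum T s x| ^ p + |signSum T s y| ^ p) := by
    intro T _
    have : signSum T s (fun i => x i - y i) = signSum T s x - signSum T s y := by
      unfold signSum
      rw [← Finset.sum_sub_distrib]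
      refine Finset.sum_congr rfl fun i _ => ?_
      split_ifs <;> ring
    rw [this]
    calc _ ≤ (|signSum T s x| + |signSum T s y|) ^ p := by gcongr; exact abs_sub _ _
      _ ≤ _ := add_pow_le (abs_nonneg _) (abs_nonneg _) p
  have h2 : ∑ T ∈ s.powerset, |signSum T s (fun i => x i - y i)| ^ p ≤
      2 ^ s.card * (2 ^ (p - 1) * ((aConst p * Real.sqrt (∑ i ∈ s, x i ^ 2)) ^ p +
        (aConst p * Real.sqrt (∑ i ∈ s, y i ^ 2)) ^ p)) := by
    refine (Finset.sum_le_sum h1).trans ?_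
    rw [← Finset.mul_sum, Finset.sum_add_distrib]
    have h3 := sum_powerset_abs_signSum_pow_le x s hp
    have h4 := sum_powerset_abs_signSum_pow_le y s hp
    calc _ ≤ (2 : ℝ) ^ (p - 1) * (2 ^ s.card * (aConst p * Real.sqrt (∑ i ∈ s, x i ^ 2)) ^ p +
          2 ^ s.card * (aConst p * Real.sqrt (∑ i ∈ s, y i ^ 2)) ^ p) := by gcongr
      _ = _ := by ring
  have h5 := ENNReal.ofReal_le_ofReal h2
  rw [ENNReal.ofReal_sum_of_nonneg (fun T _ => by positivity), ENNReal.ofReal_mul (by positivity),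
    ENNReal.ofReal_mul (by positivity), ENNReal.ofReal_add (by positivity) (by positivity),
    ENNReal.ofReal_pow zero_le_two, ENNReal.ofReal_pow zero_le_two, ENNReal.ofReal_ofNat] at h5
  refine le_of_eq_of_le (Finset.sum_congr rfl fun T _ => ?_) h5
  rw [ENNReal.ofReal_pow (abs_nonneg _), Real.enorm_eq_ofReal_abs]

theorem lintegral_prod_pi_enorm_sum_sub_pow_le {N : ℕ} {β : Type*} [MeasurableSpace β]
    (μ : Fin N → Measure β) [∀ i, IsProbabilityMeasure (μ i)] {g : β → ℝ} (hg : Measurable g)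
    {p : ℕ} (hp : 1 ≤ p) :
    ∫⁻ w : (Fin N → β) × (Fin N → β), ‖∑ i, (g (w.1 i) - g (w.2 i))‖ₑ ^ p
        ∂((Measure.pi μ).prod (Measure.pi μ)) ≤
      ∫⁻ u, ENNReal.ofReal ((2 * aConst p * Real.sqrt (∑ i, g (u i) ^ 2)) ^ p)
        ∂(Measure.pi μ) := by
  have ha := aConst_nonneg p
  set ρ := Measure.pi fun i => (μ i).prod (μ i) with hρ
  set F : (Fin N → β) → ℝ≥0∞ :=
    fun u => ENNReal.ofReal ((aConst p * Real.sqrt (∑ i, g (u i) ^ 2)) ^ p) with hF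
  have hFm : Measurable F := by fun_prop
  have hm1 : MeasurePreserving (fun (w : Fin N → β × β) i => (w i).1) ρ (Measure.pi μ) :=
    measurePreserving_pi _ _ fun i => measurePreserving_fst
  have hm2 : MeasurePreserving (fun (w : Fin N → β × β) i => (w i).2) ρ (Measure.pi μ) :=
    measurePreserving_pi _ _ fun i => measurePreserving_snd
  have hD : ∀ T : Finset (Fin N), Measurable fun w : Fin N → β × β =>
      ‖signSum T Finset.univ (fun i => g (w i).1 - g (w i).2)‖ₑ ^ p := fun T =>
    ((measurable_signSum T Finset.univ (x := fun i (w : Fin N → β × β) => g (w i).1 - g (w i).2)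
      fun i => by fun_prop).enorm).pow_const p
  -- Exchanging the two copies at the indices in `T` preserves the product law and reverses exactly
  -- those signs, so every sign pattern has the same moment.
  have hswap : ∀ T : Finset (Fin N),
      ∫⁻ w, ‖signSum T Finset.univ (fun i => g (w i).1 - g (w i).2)‖ₑ ^ p ∂ρ =
        ∫⁻ w, ‖signSum ∅ Finset.univ (fun i => g (w i).1 - g (w i).2)‖ₑ ^ p ∂ρ := by
    intro T
    have hpres : MeasurePreserving (fun (w : Fin N → β × β) i =>
        (if i ∈ T then Prod.swap else id : β × β → β × β) (w i)) ρ ρ := by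
      refine measurePreserving_pi _ _ fun i => ?_
      split_ifs
      · exact Measure.measurePreserving_swap
      · exact MeasurePreserving.id _
    rw [← hpres.lintegral_comp (hD ∅)]
    refine lintegral_congr fun w => ?_
    congr 2
    unfold signSum
    refine Finset.sum_congr rfl fun i _ => ?_
    by_cases hi : i ∈ T <;> simp [hi]
  have hI : ∫⁻ w : (Fin N → β) × (Fin N → β), ‖∑ i, (g (w.1 i) - g (w.2 i))‖ₑ ^ p
      ∂((Measure.pi μ).prod (Measure.pi μ)) =
      ∫⁻ w, ‖signSum ∅ Finset.univ (fun i => g (w i).1 - g (w i).2)‖ₑ ^ p ∂ρ := by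
    rw [← (measurePreserving_arrowProdEquivProdArrow β β (Fin N) μ μ).lintegral_comp
      (by fun_prop)]
    simp [signSum, MeasurableEquiv.arrowProdEquivProdArrow, Equiv.arrowProdEquivProdArrow, hρ]
  rw [hI]
  -- The common moment is replaced by the sum over all `2 ^ N` sign patterns, to which Khintchine
  -- applies pointwise.
  have key : (2 : ℝ≥0∞) ^ N * ∫⁻ w, ‖signSum ∅ Finset.univ
        (fun i => g (w i).1 - g (w i).2)‖ₑ ^ p ∂ρ ≤
      2 ^ N * ∫⁻ u, ENNReal.ofReal ((2 * aConst p * Real.sqrt (∑ i, g (u i) ^ 2)) ^ p)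
        ∂(Measure.pi μ) := by
    calc _ = ∑ T ∈ (Finset.univ : Finset (Fin N)).powerset,
          ∫⁻ w, ‖signSum T Finset.univ (fun i => g (w i).1 - g (w i).2)‖ₑ ^ p ∂ρ := by
          rw [Finset.sum_congr rfl fun T _ => hswap T, Finset.sum_const, Finset.card_powerset,
            Finset.card_univ, Fintype.card_fin, nsmul_eq_mul]
          norm_num
      _ = ∫⁻ w, ∑ T ∈ (Finset.univ : Finset (Fin N)).powerset,
          ‖signSum T Finset.univ (fun i => g (w i).1 - g (w i).2)‖ₑ ^ p ∂ρ :=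
          (lintegral_finsetSum _ fun T _ => hD T).symm
      _ ≤ ∫⁻ w, 2 ^ N * (2 ^ (p - 1) * (F (fun i => (w i).1) + F (fun i => (w i).2))) ∂ρ := by
          refine lintegral_mono fun w => ?_
          simpa using enorm_signSum_sub_pow_le Finset.univ (fun i => g (w i).1)
            (fun i => g (w i).2) hp
      _ = 2 ^ N * (2 ^ p * ∫⁻ u, F u ∂(Measure.pi μ)) := by
          rw [lintegral_const_mul _ (by fun_prop), lintegral_const_mul _ (by fun_prop),
            lintegral_add_left (f := fun w : Fin N → β × β => F fun i => (w i).1)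
              (hFm.comp hm1.measurable), hm1.lintegral_comp hFm,
            hm2.lintegral_comp hFm, ← two_mul, ← mul_assoc (2 ^ (p - 1)), ← pow_succ,
            Nat.sub_add_cancel hp]
      _ = _ := by
          rw [← lintegral_const_mul _ hFm]
          congr 1
          refine lintegral_congr fun u => ?_
          rw [hF, mul_assoc 2, mul_pow 2, ENNReal.ofReal_mul (by positivity),
            ENNReal.ofReal_pow zero_le_two, ENNReal.ofReal_ofNat]
  exact (ENNReal.mul_le_mul_iff_right (by positivity) (by finiteness)).1 key

/-- The mean is the integral over an independent copy; Jensen's inequality moves the power inside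
that integral. -/
theorem lintegral_pi_enorm_sum_sub_integral_pow_le {N : ℕ} {β : Type*} [MeasurableSpace β]
    (μ : Fin N → Measure β) [∀ i, IsProbabilityMeasure (μ i)] {g : β → ℝ} (hg : Measurable g)
    (hgi : ∀ i, Integrable g (μ i)) {p : ℕ} (hp : 1 ≤ p) :
    ∫⁻ u, ‖∑ i, g (u i) - ∑ i, ∫ y, g y ∂(μ i)‖ₑ ^ p ∂(Measure.pi μ) ≤
      ∫⁻ u, ENNReal.ofReal ((2 * aConst p * Real.sqrt (∑ i, g (u i) ^ 2)) ^ p)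
        ∂(Measure.pi μ) := by
  refine le_trans ?_ (lintegral_prod_pi_enorm_sum_sub_pow_le μ hg hp)
  rw [lintegral_prod _ (Measurable.aemeasurable (by fun_prop))]
  refine lintegral_mono fun u => ?_
  have hgi' : ∀ i, Integrable (fun v : Fin N → β => g (v i)) (Measure.pi μ) :=
    fun i => integrable_comp_eval (hgi i)
  have hsub : ∀ i, Integrable (fun v : Fin N → β => g (u i) - g (v i)) (Measure.pi μ) :=
    fun i => (integrable_const _).sub (hgi' i)
  have h1 : ∑ i, g (u i) - ∑ i, ∫ y, g y ∂(μ i) =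
      ∫ v, ∑ i, (g (u i) - g (v i)) ∂(Measure.pi μ) := by
    rw [integral_finsetSum _ fun i _ => hsub i,
      ← Finset.sum_sub_distrib]
    refine Finset.sum_congr rfl fun i _ => ?_
    rw [integral_sub (integrable_const _) (hgi' i),
      integral_comp_eval hg.aestronglyMeasurable]
    simp
  have h2 : ‖∑ i, g (u i) - ∑ i, ∫ y, g y ∂(μ i)‖ₑ ≤
      ∫⁻ v, ‖∑ i, (g (u i) - g (v i))‖ₑ ∂(Measure.pi μ) := by
    rw [h1]; exact enorm_integral_le_lintegral_enorm _
  have h3 := lintegral_rpow_le_lintegral_rpow (μ := Measure.pi μ)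
    (g := fun v => ‖∑ i, (g (u i) - g (v i))‖ₑ) (by fun_prop) (r := p) (by exact_mod_cast hp)
  simp only [ENNReal.rpow_natCast] at h3
  exact (by gcongr : _ ≤ _ ^ p).trans h3

/-! ### Moments of a centered empirical mean -/

theorem sqrt_mean_sq_pow_le {N : ℕ} (hN : 1 ≤ N) (x : Fin N → ℝ) (r : ℕ) :
    Real.sqrt ((∑ i, x i ^ 2) / N) ^ (2 * r) ≤ (∑ i, |x i| ^ (2 * r)) / N := by
  have hN' : (0 : ℝ) < N := by exact_mod_cast hN
  have hσ : 0 ≤ (∑ i, x i ^ 2) / N := by positivity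
  rw [pow_mul, Real.sq_sqrt hσ]
  have h := Real.pow_arith_mean_le_arith_mean_pow Finset.univ (fun _ : Fin N => (N : ℝ)⁻¹)
    (fun i => x i ^ 2) (fun _ _ => by positivity) (by simp [hN'.ne']) (fun _ _ => by positivity) r
  rw [← Finset.mul_sum, ← Finset.mul_sum] at h
  rw [div_eq_inv_mul, div_eq_inv_mul]
  refine h.trans_eq ?_
  congr 1
  refine Finset.sum_congr rfl fun i _ => ?_
  rw [pow_mul, sq_abs]

/-- The laws `μ i` may differ: only the averages over `i` of the means and of the moments of order
`p'` enter. This is what the selection step requires, since its laws depend on `i`. -/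
theorem lintegral_pi_enorm_mean_sub_pow_le {N : ℕ} (hN : 1 ≤ N) {β : Type*} [MeasurableSpace β]
    (μ : Fin N → Measure β) [∀ i, IsProbabilityMeasure (μ i)] {g : β → ℝ} (hg : Measurable g)
    (hgi : ∀ i, Integrable g (μ i)) {c : ℝ} (hc : ∑ i, ∫ y, g y ∂(μ i) = N * c) {p p' : ℕ}
    (hp : 1 ≤ p) (hp' : Even p') (hpp' : p ≤ p') {b : ℝ≥0∞}
    (hb : ∑ i, ∫⁻ y, ‖g y‖ₑ ^ p' ∂(μ i) ≤ N * b) :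
    ∫⁻ u, ‖(∑ i, g (u i)) / N - c‖ₑ ^ p ∂(Measure.pi μ) ≤
      ENNReal.ofReal (2 * aConst p / Real.sqrt N) ^ p * b ^ ((p : ℝ) / p') := by
  have ha := aConst_nonneg p
  have hN' : (0 : ℝ) < N := by exact_mod_cast hN
  have hN0 : (N : ℝ≥0∞) ≠ 0 := by exact_mod_cast (by omega : N ≠ 0)
  have hp0 : (0 : ℝ) < p := by exact_mod_cast hp
  have hp'0 : (0 : ℝ) < p' := by exact_mod_cast hp.trans hpp'
  have hr : 1 ≤ (p' : ℝ) / p := by rw [le_div_iff₀ hp0, one_mul]; exact_mod_cast hpp'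
  obtain ⟨r, hr2⟩ := hp'
  set Y : (Fin N → β) → ℝ := fun u => Real.sqrt ((∑ i, g (u i) ^ 2) / N) with hY
  have hYm : Measurable Y := by fun_prop
  have h1 : ∫⁻ u, ‖(∑ i, g (u i)) / N - c‖ₑ ^ p ∂(Measure.pi μ) =
      ENNReal.ofReal ((N : ℝ)⁻¹) ^ p *
        ∫⁻ u, ‖∑ i, g (u i) - ∑ i, ∫ y, g y ∂(μ i)‖ₑ ^ p ∂(Measure.pi μ) := by
    rw [← lintegral_const_mul _ (by fun_prop)]
    refine lintegral_congr fun u => ?_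
    rw [hc, ← mul_pow, ← Real.enorm_of_nonneg (by positivity), ← enorm_mul]
    congr 2
    field_simp
  have h2 : ENNReal.ofReal ((N : ℝ)⁻¹) ^ p *
        ∫⁻ u, ENNReal.ofReal ((2 * aConst p * Real.sqrt (∑ i, g (u i) ^ 2)) ^ p)
          ∂(Measure.pi μ) =
      ENNReal.ofReal (2 * aConst p / Real.sqrt N) ^ p *
        ∫⁻ u, ENNReal.ofReal (Y u) ^ p ∂(Measure.pi μ) := by
    rw [← lintegral_const_mul _ (by fun_prop), ← lintegral_const_mul _ (by fun_prop)]
    refine lintegral_congr fun u => ?_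
    rw [← ENNReal.ofReal_pow (by positivity), ← ENNReal.ofReal_mul (by positivity), ← mul_pow,
      ← mul_pow, ← ENNReal.ofReal_mul (by positivity), ENNReal.ofReal_pow (by positivity)]
    congr 2
    simp only [hY]
    rw [Real.sqrt_div (by positivity)]
    have := Real.sq_sqrt hN'.le
    have h0 : Real.sqrt N ≠ 0 := by positivity
    rw [div_mul_div_comm, ← sq, this]
    field_simp
  -- Jensen raises the moment from `p` to `p'`; as `p'` is even, the power-mean inequality bounds `Y
  -- ^ p'` by the mean of `|g| ^ p'`.
  have h3 : (∫⁻ u, ENNReal.ofReal (Y u) ^ p ∂(Measure.pi μ)) ^ ((p' : ℝ) / p) ≤ b := by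
    refine (lintegral_rpow_le_lintegral_rpow (by fun_prop) hr).trans ?_
    calc ∫⁻ u, (ENNReal.ofReal (Y u) ^ p) ^ ((p' : ℝ) / p) ∂(Measure.pi μ)
        ≤ ∫⁻ u, (N : ℝ≥0∞)⁻¹ * ∑ i, ‖g (u i)‖ₑ ^ p' ∂(Measure.pi μ) := by
          refine lintegral_mono fun u => ?_
          have := ENNReal.ofReal_le_ofReal (sqrt_mean_sq_pow_le hN (fun i => g (u i)) r)
          rw [← two_mul] at hr2
          rw [← ENNReal.rpow_natCast, ← ENNReal.rpow_mul, mul_div_cancel₀ _ hp0.ne',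
            ENNReal.rpow_natCast, hr2, ← ENNReal.ofReal_pow (Real.sqrt_nonneg _)]
          refine this.trans_eq ?_
          rw [div_eq_inv_mul, ENNReal.ofReal_mul (by positivity), ENNReal.ofReal_inv_of_pos hN',
            ENNReal.ofReal_natCast, ENNReal.ofReal_sum_of_nonneg fun i _ => by positivity]
          congr 1
          refine Finset.sum_congr rfl fun i _ => ?_
          rw [ENNReal.ofReal_pow (abs_nonneg _), Real.enorm_eq_ofReal_abs]
      _ = (N : ℝ≥0∞)⁻¹ * ∑ i, ∫⁻ y, ‖g y‖ₑ ^ p' ∂(μ i) := by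
          rw [lintegral_const_mul _ (by fun_prop), lintegral_finsetSum _ fun i _ => by fun_prop]
          congr 1
          refine Finset.sum_congr rfl fun i _ => ?_
          exact (measurePreserving_eval μ i).lintegral_comp (f := fun y => ‖g y‖ₑ ^ p')
            (by fun_prop)
      _ ≤ (N : ℝ≥0∞)⁻¹ * (N * b) := by gcongr
      _ = b := by rw [← mul_assoc, ENNReal.inv_mul_cancel hN0 (by finiteness), one_mul]
  rw [h1]
  refine (mul_le_mul_right (lintegral_pi_enorm_sum_sub_integral_pow_le μ hg hgi hp) _).trans ?_
  rw [h2]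
  gcongr
  calc _ = ((∫⁻ u, ENNReal.ofReal (Y u) ^ p ∂(Measure.pi μ)) ^ ((p' : ℝ) / p)) ^
        ((p : ℝ) / p') := by
        rw [← ENNReal.rpow_mul, div_mul_div_cancel₀ hp0.ne', div_self hp'0.ne', ENNReal.rpow_one]
    _ ≤ _ := by gcongr

/-! ### Selection and mutation -/

theorem empMean_pos {N : ℕ} (hN : 1 ≤ N) {α : Type*} {z : Fin N → α} {g : α → ℝ} (hg : ∀ x, 0 < g x) :
    0 < empMean z g := by
  have : Nonempty (Fin N) := ⟨⟨0, hN⟩⟩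
  unfold empMean
  have : 0 < ∑ i, g (z i) := Finset.sum_pos (fun i _ => hg _) Finset.univ_nonempty
  have : (0 : ℝ) < N := by exact_mod_cast hN
  positivity

section Selection

variable {N : ℕ} {α β : Type*} [MeasurableSpace α] [MeasurableSpace β]

theorem lintegral_selectionLaw (ε : ℝ) (G : α → ℝ) (z : Fin N → α) (i : Fin N) {φ : α → ℝ≥0∞}
    (hφ : Measurable φ) :
    ∫⁻ x, φ x ∂(selectionLaw ε G z i) = ENNReal.ofReal (ε * G (z i)) * φ (z i) +
      ENNReal.ofReal (1 - ε * G (z i)) *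
        ∑ j, ENNReal.ofReal (G (z j) / ∑ l, G (z l)) * φ (z j) := by
  simp [selectionLaw, lintegral_add_measure, lintegral_smul_measure,
    lintegral_dirac' _ hφ]

theorem isProbabilityMeasure_selectionLaw (hN : 1 ≤ N) {ε : ℝ} (hε : 0 ≤ ε) {G : α → ℝ}
    (hG : ∀ x, 0 < G x) (hεG : ∀ x, ε * G x ≤ 1) (z : Fin N → α) (i : Fin N) :
    IsProbabilityMeasure (selectionLaw ε G z i) := by
  have : Nonempty (Fin N) := ⟨⟨0, hN⟩⟩
  have hS : 0 < ∑ l, G (z l) := Finset.sum_pos (fun i _ => hG _) Finset.univ_nonempty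
  constructor
  have h := lintegral_selectionLaw ε G z i (φ := fun _ => 1) measurable_const
  rw [lintegral_one] at h
  have hs : ∑ j, ENNReal.ofReal (G (z j) / ∑ l, G (z l)) = 1 := by
    rw [← ENNReal.ofReal_sum_of_nonneg fun j _ => div_nonneg (hG _).le hS.le, ← Finset.sum_div,
      div_self hS.ne', ENNReal.ofReal_one]
  have := hεG (z i)
  have := mul_nonneg hε (hG (z i)).le
  simp only [mul_one] at h
  rw [h, hs, mul_one, ← ENNReal.ofReal_add (by linarith) (by linarith)]
  simp

/-- The parameter `ε` disappears on summing over `i`: the particles that stay contribute `ε ∑ G`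
times the `G`-weighted mean of `φ`, and those that jump contribute `N - ε ∑ G` times the same mean.
-/
theorem sum_lintegral_selectionLaw (hN : 1 ≤ N) {ε : ℝ} (hε : 0 ≤ ε) {G : α → ℝ}
    (hG : ∀ x, 0 < G x) (hεG : ∀ x, ε * G x ≤ 1) (z : Fin N → α) {φ : α → ℝ≥0∞}
    (hφ : Measurable φ) :
    ∑ i, ∫⁻ x, φ x ∂(selectionLaw ε G z i) =
      N * ∑ j, ENNReal.ofReal (G (z j) / ∑ l, G (z l)) * φ (z j) := by
  have : Nonempty (Fin N) := ⟨⟨0, hN⟩⟩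
  have hS : 0 < ∑ l, G (z l) := Finset.sum_pos (fun i _ => hG _) Finset.univ_nonempty
  simp only [lintegral_selectionLaw ε G z _ hφ]
  rw [Finset.sum_add_distrib, ← Finset.sum_mul]
  have h1 : ∑ i, ENNReal.ofReal (ε * G (z i)) * φ (z i) =
      ENNReal.ofReal (ε * ∑ l, G (z l)) *
        ∑ j, ENNReal.ofReal (G (z j) / ∑ l, G (z l)) * φ (z j) := by
    rw [Finset.mul_sum]
    refine Finset.sum_congr rfl fun i _ => ?_
    rw [← mul_assoc, ← ENNReal.ofReal_mul (by positivity)]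
    congr 2
    field_simp
  rw [h1, ← add_mul, ← ENNReal.ofReal_sum_of_nonneg fun i _ => sub_nonneg.2 (hεG _),
    ← ENNReal.ofReal_add (by positivity) (Finset.sum_nonneg fun i _ => sub_nonneg.2 (hεG _)),
    Finset.sum_sub_distrib, ← Finset.mul_sum]
  simp

theorem isProbabilityMeasure_selectionLaw_bind (hN : 1 ≤ N) {ε : ℝ} (hε : 0 ≤ ε) {G : α → ℝ}
    (hG : ∀ x, 0 < G x) (hεG : ∀ x, ε * G x ≤ 1) (M : Kernel α β) [IsMarkovKernel M]
    (z : Fin N → α) (i : Fin N) : IsProbabilityMeasure ((selectionLaw ε G z i).bind M) := by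
  have := isProbabilityMeasure_selectionLaw hN hε hG hεG z i
  infer_instance

theorem measurable_lintegral_selectionLaw (ε : ℝ) {G : α → ℝ} (hG : Measurable G) (i : Fin N)
    {φ : α → ℝ≥0∞} (hφ : Measurable φ) :
    Measurable fun z : Fin N → α => ∫⁻ x, φ x ∂(selectionLaw ε G z i) := by
  simp only [lintegral_selectionLaw ε G _ _ hφ]
  fun_prop

/-- Measurable boxes form a generating π-system, and the mass of a box is a finite product of
measurable functions of `z`. -/
theorem measurable_particleStep (hN : 1 ≤ N) {ε : ℝ} (hε : 0 ≤ ε) {G : α → ℝ}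
    (hGm : Measurable G) (hG : ∀ x, 0 < G x) (hεG : ∀ x, ε * G x ≤ 1) (M : Kernel α β)
    [IsMarkovKernel M] : Measurable fun z : Fin N → α => particleStep ε G M z := by
  have := isProbabilityMeasure_selectionLaw_bind hN hε hG hεG M
  have : ∀ z : Fin N → α, IsProbabilityMeasure (particleStep ε G M z) := fun z => by
    unfold particleStep; infer_instance
  refine .measure_of_isPiSystem_of_isProbabilityMeasure generateFrom_pi.symm isPiSystem_pi ?_
  rintro _ ⟨s, hs, rfl⟩
  simp only [Set.mem_pi, Set.mem_univ, true_implies, Set.mem_ofPred_eq] at hs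
  unfold particleStep
  simp only [Measure.pi_pi]
  refine Finset.measurable_fun_prod _ fun i _ => ?_
  simp only [Measure.bind_apply (hs i) M.measurable.aemeasurable]
  exact measurable_lintegral_selectionLaw ε hGm i (M.measurable_coe (hs i))

/-- `particleStep` as a Markov kernel. -/
noncomputable def particleKernel (hN : 1 ≤ N) {ε : ℝ} (hε : 0 ≤ ε) {G : α → ℝ}
    (hGm : Measurable G) (hG : ∀ x, 0 < G x) (hεG : ∀ x, ε * G x ≤ 1) (M : Kernel α β)
    [IsMarkovKernel M] : Kernel (Fin N → α) (Fin N → β) :=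
  ⟨fun z => particleStep ε G M z, measurable_particleStep hN hε hGm hG hεG M⟩

theorem isMarkovKernel_particleKernel (hN : 1 ≤ N) {ε : ℝ} (hε : 0 ≤ ε) {G : α → ℝ}
    (hGm : Measurable G) (hG : ∀ x, 0 < G x) (hεG : ∀ x, ε * G x ≤ 1) (M : Kernel α β)
    [IsMarkovKernel M] : IsMarkovKernel (particleKernel (N := N) hN hε hGm hG hεG M) := by
  have := isProbabilityMeasure_selectionLaw_bind (N := N) hN hε hG hεG M
  refine ⟨fun z => ?_⟩
  change IsProbabilityMeasure (Measure.pi _)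
  infer_instance

end Selection

/-! ### The weights -/

section Weights

variable {E : ℕ → Type*} {N : ℕ} {G : ∀ k, E k → ℝ} {H : ∀ k, E k → E (k + 1) → ℝ} {k : ℕ}

theorem meshWeight_nonneg (hG : ∀ x, 0 < G k x) (hH : ∀ x y, 0 < H k x y) (z : Fin N → E k)
    (x : E k) (y : E (k + 1)) : 0 ≤ meshWeight G H k z x y := by
  have h1 : 0 ≤ empMean z (G k) :=
    div_nonneg (Finset.sum_nonneg fun i _ => (hG _).le) (Nat.cast_nonneg _)
  have h2 : 0 ≤ empMean z (fun w => G k w * H k w y) :=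
    div_nonneg (Finset.sum_nonneg fun i _ => (mul_pos (hG _) (hH _ _)).le) (Nat.cast_nonneg _)
  have := hG x
  have := hH x y
  unfold meshWeight
  positivity

/-- Averaging the numerator over the particles reproduces the denominator. This controls the mass of
the path weights without any density ratio after the first step. -/
theorem mean_meshWeight (hN : 1 ≤ N) (hG : ∀ x, 0 < G k x) (hH : ∀ x y, 0 < H k x y)
    (z : Fin N → E k) (y : E (k + 1)) :
    empMean z (fun x => meshWeight G H k z x y) = empMean z (G k) := by
  have h2 := empMean_pos hN (z := z) (g := fun w => G k w * H k w y)
    fun w => mul_pos (hG _) (hH _ _)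
  have h : empMean z (fun x => meshWeight G H k z x y) =
      empMean z (fun w => G k w * H k w y) * empMean z (G k) /
        empMean z (fun w => G k w * H k w y) := by
    unfold meshWeight
    conv_rhs => rw [mul_div_assoc]; unfold empMean
    conv_lhs => unfold empMean
    simp_rw [mul_div_assoc, ← Finset.sum_mul]
    ring
  rw [h, mul_div_cancel_left₀ _ h2.ne']

/-- From `H k x y ≤ h(y) * H k w y` for every `w`, averaged over the particles with weights `G`.
When `h(y) = ∞` the right side is infinite because `G > 0`. -/
theorem ofReal_meshWeight_le (hN : 1 ≤ N) (hG : ∀ x, 0 < G k x) (hH : ∀ x y, 0 < H k x y)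
    (z : Fin N → E k) (x : E k) (y : E (k + 1)) :
    ENNReal.ofReal (meshWeight G H k z x y) ≤ ENNReal.ofReal (G k x) * hRatio H (k + 1) y := by
  by_cases ht : hRatio H (k + 1) y = ∞
  · rw [ht, ENNReal.mul_top (by simpa using hG x)]; exact le_top
  have h2 := empMean_pos hN (z := z) (g := fun w => G k w * H k w y)
    fun w => mul_pos (hG _) (hH _ _)
  rw [← ENNReal.ofReal_toReal ht, ← ENNReal.ofReal_mul (hG x).le]
  refine ENNReal.ofReal_le_ofReal ?_
  set t := (hRatio H (k + 1) y).toReal with htd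
  have h1 : ∀ w, H k x y ≤ t * H k w y := by
    intro w
    have h : ENNReal.ofReal (H k x y / H k w y) ≤ hRatio H (k + 1) y :=
      le_iSup₂_of_le (f := fun (x x' : E k) => ENNReal.ofReal (H k x y / H k x' y)) x w le_rfl
    rw [ENNReal.ofReal_le_iff_le_toReal ht] at h
    exact (div_le_iff₀ (hH w y)).1 h
  unfold meshWeight
  rw [div_le_iff₀ h2]
  have h3 : H k x y * empMean z (G k) ≤ t * empMean z (fun w => G k w * H k w y) := by
    unfold empMean
    rw [mul_div_assoc', mul_div_assoc', Finset.mul_sum, Finset.mul_sum]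
    refine div_le_div_of_nonneg_right (Finset.sum_le_sum fun i _ => ?_) (Nat.cast_nonneg _)
    have := h1 (z i)
    have := hG (z i)
    nlinarith
  have := hG x
  nlinarith

variable [∀ k, MeasurableSpace (E k)]

theorem measurable_empMean {γ α : Type*} [MeasurableSpace γ] [MeasurableSpace α]
    {z : γ → Fin N → α} {g : γ → α → ℝ} (hz : Measurable z)
    (hg : Measurable (Function.uncurry g)) : Measurable fun c => empMean (z c) (g c) := by
  refine (Finset.measurable_fun_sum _ fun i _ => ?_).div_const _
  exact hg.comp (measurable_id.prodMk ((measurable_pi_apply i).comp hz))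

theorem measurable_meshWeight (hGm : Measurable (G k)) (hHm : Measurable (Function.uncurry (H k)))
    {γ : Type*} [MeasurableSpace γ] {z : γ → Fin N → E k} {x : γ → E k} {y : γ → E (k + 1)}
    (hz : Measurable z) (hx : Measurable x) (hy : Measurable y) :
    Measurable fun c => meshWeight G H k (z c) (x c) (y c) := by
  refine (((hGm.comp hx).mul (hHm.comp (hx.prodMk hy))).mul
    (measurable_empMean (g := fun _ => G k) hz (hGm.comp measurable_snd))).div (measurable_empMean hz ?_)
  exact (hGm.comp measurable_snd).mul
    (hHm.comp (measurable_snd.prodMk (hy.comp measurable_fst)))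

variable {M : ∀ k, Kernel (E k) (E (k + 1))} {ν : ∀ k, Measure (E (k + 1))} {ε : ℝ}

/-- Importance sampling by the selected and mutated particles is unbiased. -/
theorem sum_lintegral_meshWeight_mul (hN : 1 ≤ N) (hGm : Measurable (G k)) (hG : ∀ x, 0 < G k x)
    (hHm : Measurable (Function.uncurry (H k))) (hH : ∀ x y, 0 < H k x y)
    (hM : ∀ x, M k x = (ν k).withDensity (fun y => ENNReal.ofReal (H k x y)))
    (hε : 0 ≤ ε) (hεG : ∀ x, ε * G k x ≤ 1) (z : Fin N → E k) (x : E k)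
    {ψ : E (k + 1) → ℝ≥0∞} (hψ : Measurable ψ) :
    ∑ i, ∫⁻ u, ENNReal.ofReal (meshWeight G H k z x u) * ψ u
        ∂((selectionLaw ε (G k) z i).bind (M k)) =
      N * (ENNReal.ofReal (G k x) * ∫⁻ u, ψ u ∂(M k x)) := by
  have : Nonempty (Fin N) := ⟨⟨0, hN⟩⟩
  have hS : 0 < ∑ l, G k (z l) := Finset.sum_pos (fun i _ => hG _) Finset.univ_nonempty
  have hN' : (0 : ℝ) < N := by exact_mod_cast hN
  have hHx : ∀ w, Measurable fun u => ENNReal.ofReal (H k w u) := fun w =>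
    (hHm.comp measurable_prodMk_left).ennreal_ofReal
  have hW : Measurable fun u => ENNReal.ofReal (meshWeight G H k z x u) * ψ u :=
    (measurable_meshWeight hGm hHm measurable_const measurable_const
      measurable_id).ennreal_ofReal.mul hψ
  have hdens : ∀ w {φ : E (k + 1) → ℝ≥0∞}, Measurable φ →
      ∫⁻ u, φ u ∂(M k w) = ∫⁻ u, ENNReal.ofReal (H k w u) * φ u ∂(ν k) := fun w φ hφ => by
    rw [hM w, lintegral_withDensity_eq_lintegral_mul _ (hHx w) hφ]; rfl
  simp only [Measure.lintegral_bind (M k).measurable.aemeasurable hW.aemeasurable]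
  rw [sum_lintegral_selectionLaw hN hε hG hεG z hW.lintegral_kernel]
  congr 1
  rw [hdens x hψ, ← lintegral_const_mul _ ((hHx x).fun_mul hψ)]
  simp only [hdens _ hW]
  simp only [← lintegral_const_mul _ ((hHx _).fun_mul hW)]
  rw [← lintegral_finsetSum _ fun j _ => ((hHx _).fun_mul hW).const_mul _]
  refine lintegral_congr fun u => ?_
  have h2 := empMean_pos hN (z := z) (g := fun w => G k w * H k w u)
    fun w => mul_pos (hG _) (hH _ _)
  simp_rw [← mul_assoc, ← Finset.sum_mul]
  congr 1
  have h3 : ∀ j, 0 ≤ G k (z j) / ∑ l, G k (z l) := fun j => div_nonneg (hG _).le hS.le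
  simp_rw [← fun j => ENNReal.ofReal_mul (q := H k (z j) u) (h3 j)]
  rw [← ENNReal.ofReal_sum_of_nonneg fun j _ => mul_nonneg (h3 j) (hH _ _).le,
    ← ENNReal.ofReal_mul (Finset.sum_nonneg fun j _ => mul_nonneg (h3 j) (hH _ _).le),
    ← ENNReal.ofReal_mul (hG x).le]
  congr 1
  -- The left side is the density of the averaged law of the new particles; it cancels against the
  -- weight and leaves `G k x * H k x u`.
  have h4 : ∑ j, G k (z j) / (∑ l, G k (z l)) * H k (z j) u =
      empMean z (fun w => G k w * H k w u) / empMean z (G k) := by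
    unfold empMean
    rw [div_div_div_cancel_right₀ hN'.ne', Finset.sum_div]
    exact Finset.sum_congr rfl fun j _ => by ring
  have h5 := empMean_pos hN (z := z) hG
  rw [h4]
  unfold meshWeight
  field_simp

/-- The unbiasedness identity for `‖v‖` has a finite right side, so each summand on the left is
finite. -/
theorem integrable_meshWeight_mul (hN : 1 ≤ N) (hGm : Measurable (G k)) (hG : ∀ x, 0 < G k x)
    (hHm : Measurable (Function.uncurry (H k))) (hH : ∀ x y, 0 < H k x y)
    (hM : ∀ x, M k x = (ν k).withDensity (fun y => ENNReal.ofReal (H k x y)))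
    (hε : 0 ≤ ε) (hεG : ∀ x, ε * G k x ≤ 1) (z : Fin N → E k) (x : E k)
    {v : E (k + 1) → ℝ} (hv : Measurable v) (hvi : Integrable v (M k x)) (i : Fin N) :
    Integrable (fun u => meshWeight G H k z x u * v u)
      ((selectionLaw ε (G k) z i).bind (M k)) := by
  refine ⟨((measurable_meshWeight hGm hHm measurable_const measurable_const
      measurable_id).mul hv).aestronglyMeasurable, ?_⟩
  have h := sum_lintegral_meshWeight_mul hN hGm hG hHm hH hM hε hεG z x hv.enorm
  have hlt : (N : ℝ≥0∞) * (ENNReal.ofReal (G k x) * ∫⁻ u, ‖v u‖ₑ ∂(M k x)) < ∞ :=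
    ENNReal.mul_lt_top (by finiteness) (ENNReal.mul_lt_top (by finiteness) hvi.2)
  rw [← h] at hlt
  refine lt_of_le_of_lt ?_ (ENNReal.sum_lt_top.1 hlt i (Finset.mem_univ _))
  refine lintegral_mono fun u => ?_
  rw [enorm_mul, Real.enorm_of_nonneg (meshWeight_nonneg hG hH z x u)]

theorem sum_integral_meshWeight_mul (hN : 1 ≤ N) (hGm : Measurable (G k)) (hG : ∀ x, 0 < G k x)
    (hHm : Measurable (Function.uncurry (H k))) (hH : ∀ x y, 0 < H k x y)
    (hM : ∀ x, M k x = (ν k).withDensity (fun y => ENNReal.ofReal (H k x y)))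
    (hε : 0 ≤ ε) (hεG : ∀ x, ε * G k x ≤ 1) (z : Fin N → E k) (x : E k)
    {v : E (k + 1) → ℝ} (hv : Measurable v) (hvi : Integrable v (M k x)) :
    ∑ i, ∫ u, meshWeight G H k z x u * v u ∂((selectionLaw ε (G k) z i).bind (M k)) =
      N * (G k x * ∫ u, v u ∂(M k x)) := by
  have key : ∀ {w : E (k + 1) → ℝ}, Measurable w → Integrable w (M k x) →
      ∑ i, (∫⁻ u, ENNReal.ofReal (meshWeight G H k z x u * w u)
          ∂((selectionLaw ε (G k) z i).bind (M k))).toReal =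
        N * (G k x * (∫⁻ u, ENNReal.ofReal (w u) ∂(M k x)).toReal) := by
    intro w hw hwi
    have h := sum_lintegral_meshWeight_mul hN hGm hG hHm hH hM hε hεG z x hw.ennreal_ofReal
    simp only [← fun u => ENNReal.ofReal_mul (q := w u) (meshWeight_nonneg hG hH z x u)] at h
    rw [← ENNReal.toReal_sum fun i _ => ?_, h, ENNReal.toReal_mul, ENNReal.toReal_mul,
      ENNReal.toReal_ofReal (hG x).le, ENNReal.toReal_natCast]
    exact (integrable_meshWeight_mul hN hGm hG hHm hH hM hε hεG z x hw hwi i).lintegral_lt_top.ne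
  have h1 := key hv hvi
  have h2 := key hv.neg hvi.neg
  simp only [Pi.neg_apply] at h2
  simp only [integral_eq_lintegral_pos_part_sub_lintegral_neg_part
    (integrable_meshWeight_mul hN hGm hG hHm hH hM hε hεG z x hv hvi _),
    integral_eq_lintegral_pos_part_sub_lintegral_neg_part hvi, ← mul_neg]
  rw [Finset.sum_sub_distrib, h1, h2]
  ring

/-- Conditional moments of the fluctuation of one step of the particle approximation. -/
theorem lintegral_particleStep_fluctuation_le [∀ k, IsMarkovKernel (M k)] (hN : 1 ≤ N) (hGm : Measurable (G k))
    (hG : ∀ x, 0 < G k x) (hHm : Measurable (Function.uncurry (H k))) (hH : ∀ x y, 0 < H k x y)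
    (hM : ∀ x, M k x = (ν k).withDensity (fun y => ENNReal.ofReal (H k x y)))
    (hε : 0 ≤ ε) (hεG : ∀ x, ε * G k x ≤ 1) (z : Fin N → E k) (x : E k)
    {v : E (k + 1) → ℝ} (hv : Measurable v) (hvi : Integrable v (M k x))
    {p p' : ℕ} (hp : 1 ≤ p) (hp' : Even p') (hpp' : p ≤ p') :
    ∫⁻ u, ‖empMean u (fun y => meshWeight G H k z x y * v y) - G k x * ∫ y, v y ∂(M k x)‖ₑ ^ p
        ∂(particleStep ε (G k) (M k) z) ≤
      ENNReal.ofReal (2 * aConst p / Real.sqrt N) ^ p *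
        (supNormG G k ^ (p' - 1) * (ENNReal.ofReal (G k x) *
          ∫⁻ y, hRatio H (k + 1) y ^ (p' - 1) * ENNReal.ofReal (v y ^ p') ∂(M k x))) ^
            ((p : ℝ) / p') := by
  have := isProbabilityMeasure_selectionLaw_bind hN hε hG hεG (M k) z
  have hWm : Measurable fun u => meshWeight G H k z x u :=
    measurable_meshWeight hGm hHm measurable_const measurable_const measurable_id
  refine lintegral_pi_enorm_mean_sub_pow_le hN _ (hWm.mul hv)
    (integrable_meshWeight_mul hN hGm hG hHm hH hM hε hεG z x hv hvi)
    (sum_integral_meshWeight_mul hN hGm hG hHm hH hM hε hεG z x hv hvi) hp hp' hpp' ?_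
  -- One factor of the weight is set aside for the unbiasedness identity; only the other `p' - 1`
  -- are bounded by `G * h`.
  have hsplit : ∀ u, ‖meshWeight G H k z x u * v u‖ₑ ^ p' =
      ENNReal.ofReal (meshWeight G H k z x u) *
        (ENNReal.ofReal (meshWeight G H k z x u) ^ (p' - 1) * ‖v u‖ₑ ^ p') := by
    intro u
    rw [enorm_mul, mul_pow, Real.enorm_of_nonneg (meshWeight_nonneg hG hH z x u), ← mul_assoc,
      ← pow_succ', Nat.sub_add_cancel (hp.trans hpp')]
  simp only [Pi.mul_apply, hsplit]
  rw [sum_lintegral_meshWeight_mul hN hGm hG hHm hH hM hε hεG z x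
    ((hWm.ennreal_ofReal.pow_const _).fun_mul (hv.enorm.pow_const _))]
  rw [mul_left_comm (supNormG G k ^ _)]
  gcongr
  have hGx : ENNReal.ofReal (G k x) ≤ supNormG G k := by
    refine le_iSup_of_le x ?_
    rw [abs_of_pos (hG x)]
  calc ∫⁻ u, ENNReal.ofReal (meshWeight G H k z x u) ^ (p' - 1) * ‖v u‖ₑ ^ p' ∂(M k x)
      ≤ ∫⁻ u, ENNReal.ofReal (G k x) ^ (p' - 1) *
          (hRatio H (k + 1) u ^ (p' - 1) * ENNReal.ofReal (v u ^ p')) ∂(M k x) := by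
        refine lintegral_mono fun u => ?_
        dsimp only
        rw [← mul_assoc, ← mul_pow, ← hp'.pow_abs (v u), ENNReal.ofReal_pow (abs_nonneg _),
          Real.enorm_eq_ofReal_abs]
        gcongr
        exact ofReal_meshWeight_le hN hG hH z x u
    _ = ENNReal.ofReal (G k x) ^ (p' - 1) *
          ∫⁻ u, hRatio H (k + 1) u ^ (p' - 1) * ENNReal.ofReal (v u ^ p') ∂(M k x) :=
        lintegral_const_mul' _ _ (by finiteness)
    _ ≤ _ := by gcongr

end Weights

/-! ### The Markov property of the particle model -/

section Chain

variable {E : ℕ → Type*} [∀ k, MeasurableSpace (E k)] {N : ℕ} {Ω : Type*} [mΩ : MeasurableSpace Ω]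
  {η₀ : Measure (E 0)} {M : ∀ k, Kernel (E k) (E (k + 1))} [∀ k, IsMarkovKernel (M k)]
  {G : ∀ k, E k → ℝ} {ε : ℝ} {n : ℕ} {P : Measure Ω} [IsProbabilityMeasure P]
  {ξ : ∀ k, Ω → Fin N → E k}

/-- The sigma-field generated by `ξ 0, …, ξ k`. -/
abbrev pastSigma (ξ : ∀ k, Ω → Fin N → E k) (k : ℕ) : MeasurableSpace Ω :=
  ⨆ j ≤ k, MeasurableSpace.comap (ξ j) inferInstance

omit mΩ in
theorem measurable_pastSigma {j k : ℕ} (hjk : j ≤ k) : Measurable[pastSigma ξ k] (ξ j) :=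
  Measurable.of_comap_le
    (le_iSup₂_of_le (f := fun i (_ : i ≤ k) => MeasurableSpace.comap (ξ i) inferInstance)
      j hjk le_rfl)

theorem pastSigma_le (hξ : ∀ k ≤ n, Measurable (ξ k)) {k : ℕ} (hk : k ≤ n) :
    pastSigma ξ k ≤ mΩ :=
  iSup₂_le fun j hj => (hξ j (hj.trans hk)).comap_le

/-- `Z` carries any data known at time `k`, such as path weights and positions, so that they are
constants in the inner integral. -/
theorem IsParticleModel.lintegral_step (hξ : IsParticleModel η₀ M G ε n P ξ) (hN : 1 ≤ N)
    (hε : 0 ≤ ε) {k : ℕ} (hk : k < n) (hGm : Measurable (G k)) (hG : ∀ x, 0 < G k x)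
    (hεG : ∀ x, ε * G k x ≤ 1) {X : Type*} [MeasurableSpace X] {Z : Ω → X}
    (hZ : Measurable[pastSigma ξ k] Z) {Ψ : X × (Fin N → E (k + 1)) → ℝ≥0∞} (hΨ : Measurable Ψ) :
    ∫⁻ ω, Ψ (Z ω, ξ (k + 1) ω) ∂P =
      ∫⁻ ω, ∫⁻ u, Ψ (Z ω, u) ∂(particleStep ε (G k) (M k) (ξ k ω)) ∂P := by
  have hle := pastSigma_le hξ.measurable hk.le
  have hξk := hξ.measurable k hk.le
  have hξk1 := hξ.measurable (k + 1) hk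
  -- Adjoining `ξ k` makes the conditional law of `ξ (k + 1)` a kernel in the conditioning variable;
  -- the joint laws are then compared on rectangles.
  have hZ' : Measurable[pastSigma ξ k] fun ω => (Z ω, ξ k ω) :=
    hZ.prodMk (measurable_pastSigma le_rfl)
  have hZm : Measurable fun ω => (Z ω, ξ k ω) := hZ'.mono hle le_rfl
  have := isMarkovKernel_particleKernel (N := N) hN hε hGm hG hεG (M k)
  set K := (particleKernel (N := N) hN hε hGm hG hεG (M k)).comap
    (Prod.snd : X × (Fin N → E k) → Fin N → E k) measurable_snd with hK
  have hlaw : P.map (fun ω => ((Z ω, ξ k ω), ξ (k + 1) ω)) =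
      (P.map fun ω => (Z ω, ξ k ω)) ⊗ₘ K := by
    have : IsFiniteMeasure (P.map fun ω => ((Z ω, ξ k ω), ξ (k + 1) ω)) := inferInstance
    refine Measure.ext_prod fun {s t} hs ht => ?_
    have : IsProbabilityMeasure (P.map fun ω => (Z ω, ξ k ω)) :=
      Measure.isProbabilityMeasure_map hZm.aemeasurable
    rw [Measure.map_apply (hZm.prodMk hξk1) (hs.prod ht), Measure.compProd_apply_prod hs ht,
      setLIntegral_map hs (K.measurable_coe ht) hZm]
    exact hξ.step k hk _ (hZ' hs) t ht
  have hΨ' : Measurable fun q : (X × (Fin N → E k)) × (Fin N → E (k + 1)) => Ψ (q.1.1, q.2) := by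
    fun_prop
  have : IsProbabilityMeasure (P.map fun ω => (Z ω, ξ k ω)) :=
    Measure.isProbabilityMeasure_map hZm.aemeasurable
  calc ∫⁻ ω, Ψ (Z ω, ξ (k + 1) ω) ∂P
      = ∫⁻ q, Ψ (q.1.1, q.2) ∂(P.map (fun ω => ((Z ω, ξ k ω), ξ (k + 1) ω))) :=
        (lintegral_map hΨ' (hZm.prodMk hξk1)).symm
    _ = ∫⁻ a, ∫⁻ u, Ψ (a.1, u) ∂(K a) ∂(P.map fun ω => (Z ω, ξ k ω)) := by
        rw [hlaw, Measure.lintegral_compProd hΨ']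
    _ = _ := lintegral_map hΨ'.lintegral_kernel_prod_right' hZm

end Chain

section Model

variable {E : ℕ → Type*} [∀ k, MeasurableSpace (E k)]

/-- The standing assumptions on the potentials `G`, the transitions `M`, with densities `H` with
respect to `ν`, and the selection parameter `ε`, up to the horizon `n`. -/
structure IsDensityModel (n : ℕ) (G : ∀ k, E k → ℝ) (M : ∀ k, Kernel (E k) (E (k + 1)))
    (ν : ∀ k, Measure (E (k + 1))) (H : ∀ k, E k → E (k + 1) → ℝ) (ε : ℝ) : Prop where
  measurable_potential : ∀ k < n, Measurable (G k)
  potential_pos : ∀ k < n, ∀ x, 0 < G k x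
  measurable_density : ∀ k < n, Measurable (Function.uncurry (H k))
  density_pos : ∀ k < n, ∀ x y, 0 < H k x y
  eq_withDensity : ∀ k < n, ∀ x, M k x = (ν k).withDensity (fun y => ENNReal.ofReal (H k x y))
  nonneg : 0 ≤ ε
  mul_potential_le_one : ∀ k < n, ∀ x, ε * G k x ≤ 1

variable {f G : ∀ k, E k → ℝ} {M : ∀ k, Kernel (E k) (E (k + 1))}
  {ν : ∀ k, Measure (E (k + 1))} {H : ∀ k, E k → E (k + 1) → ℝ} {ε : ℝ} {n N : ℕ}

/-! ### The operators `Q` and the Snell envelope -/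

/-- The operators `Q_{m+1}` applied to the members of a family of functions. -/
noncomputable def QStep (G : ∀ k, E k → ℝ) (M : ∀ k, Kernel (E k) (E (k + 1)))
    (g : ∀ k, E k → ℝ≥0∞) (m : ℕ) (x : E m) : ℝ≥0∞ :=
  ENNReal.ofReal (G m x) * ∫⁻ y, g (m + 1) y ∂(M m x)

/-- `QSteps` unfolds at its first operator, whereas path weights grow at the last time; this peels
off the last operator instead. -/
theorem QSteps_succ_eq (g : ∀ k, E k → ℝ≥0∞) (j k : ℕ) :
    QSteps G M g (j + 1) k = QSteps G M (QStep G M g) j k := by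
  induction j generalizing k with
  | zero => rfl
  | succ j ih =>
    funext x
    rw [QSteps, ih, QSteps]

/-- Every `M k x` is absolutely continuous with respect to `ν k`, so one measurable version of `g`
serves for all `x`. This is why `hRatio` need only be measurable up to null sets. -/
theorem IsDensityModel.measurable_QStep (hm : IsDensityModel n G M ν H ε) {g : ∀ k, E k → ℝ≥0∞}
    {k : ℕ} (hk : k < n) (hg : AEMeasurable (g (k + 1)) (ν k)) : Measurable (QStep G M g k) := by
  refine (hm.measurable_potential k hk).ennreal_ofReal.mul ?_
  have h : ∀ x, ∫⁻ y, g (k + 1) y ∂(M k x) = ∫⁻ y, hg.mk _ y ∂(M k x) := fun x =>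
    lintegral_congr_ae <| by
      rw [hm.eq_withDensity k hk x]
      exact (withDensity_absolutelyContinuous _ _).ae_le hg.ae_eq_mk
  simp only [h]
  exact hg.measurable_mk.lintegral_kernel

theorem measurable_QSteps (hG : ∀ k < n, Measurable (G k)) {g : ∀ k, E k → ℝ≥0∞}
    (hg : ∀ k ≤ n, Measurable (g k)) (j k : ℕ) (hjk : k + j ≤ n) :
    Measurable (QSteps G M g j k) := by
  induction j generalizing k with
  | zero => exact hg k hjk
  | succ j ih =>
    exact (hG k (by omega)).ennreal_ofReal.mul (ih (k + 1) (by omega)).lintegral_kernel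

theorem measurable_snellSteps (hf : ∀ k ≤ n, Measurable (f k)) (hG : ∀ k < n, Measurable (G k))
    (j k : ℕ) (hjk : k + j ≤ n) : Measurable (snellSteps f G M j k) := by
  induction j generalizing k with
  | zero => exact hf k hjk
  | succ j ih =>
    exact (hf k (by omega)).max ((hG k (by omega)).mul
      (ih (k + 1) (by omega)).stronglyMeasurable.integral_kernel.measurable)

theorem enorm_snellSteps_le (hf : ∀ k ≤ n, Measurable (f k)) (hG : ∀ k < n, Measurable (G k))
    (hGpos : ∀ k < n, ∀ x, 0 < G k x) (j k : ℕ) (hjk : k + j ≤ n) (x : E k) :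
    ‖snellSteps f G M j k x‖ₑ ≤
      ∑ i ∈ Finset.range (j + 1), QSteps G M (fun m y => ENNReal.ofReal |f m y|) i k x := by
  induction j generalizing k with
  | zero => simp [snellSteps, QSteps, Real.enorm_eq_ofReal_abs]
  | succ j ih =>
    have h1 : ‖snellSteps f G M (j + 1) k x‖ₑ ≤
        ‖f k x‖ₑ + ‖G k x * ∫ y, snellSteps f G M j (k + 1) y ∂(M k x)‖ₑ := by
      rw [snellSteps]
      rcases max_choice (f k x) (G k x * ∫ y, snellSteps f G M j (k + 1) y ∂(M k x)) with h | h
      · rw [h]; exact le_self_add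
      · rw [h]; exact le_add_self
    refine h1.trans ?_
    rw [Finset.sum_range_succ', add_comm]
    refine add_le_add ?_ (by simp [QSteps, Real.enorm_eq_ofReal_abs])
    simp only [QSteps]
    rw [← Finset.mul_sum, ← lintegral_finsetSum _ fun i hi =>
      measurable_QSteps hG (fun m hm => (hf m hm).abs.ennreal_ofReal) i (k + 1)
        (by have := Finset.mem_range.1 hi; omega), enorm_mul,
      Real.enorm_of_nonneg (hGpos k (by omega) x).le]
    gcongr
    refine (enorm_integral_le_lintegral_enorm _).trans (lintegral_mono fun y => ?_)
    exact ih (k + 1) (by omega) y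

theorem integrable_snellSteps (hf : ∀ k ≤ n, Measurable (f k)) (hG : ∀ k < n, Measurable (G k))
    (hGpos : ∀ k < n, ∀ x, 0 < G k x)
    (hint : ∀ k l, k ≤ l → l ≤ n → ∀ x, Qop G M k l (fun m y => ENNReal.ofReal |f m y|) x < ∞)
    (j k : ℕ) (hjk : k + 1 + j ≤ n) (x : E k) :
    Integrable (snellSteps f G M j (k + 1)) (M k x) := by
  refine ⟨(measurable_snellSteps hf hG j (k + 1) hjk).aestronglyMeasurable, ?_⟩
  refine lt_of_le_of_lt
    (lintegral_mono fun y => enorm_snellSteps_le hf hG hGpos j (k + 1) hjk y) ?_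
  rw [lintegral_finsetSum _ fun i hi =>
      measurable_QSteps hG (fun m hm => (hf m hm).abs.ennreal_ofReal) i (k + 1)
        (by have := Finset.mem_range.1 hi; omega)]
  refine ENNReal.sum_lt_top.2 fun i hi => ?_
  have hi' := Finset.mem_range.1 hi
  have h := hint k (k + (i + 1)) (by omega) (by omega) x
  rw [Qop, Nat.add_sub_cancel_left, QSteps] at h
  -- The hypothesis bounds `G k x` times the integral; positivity of `G k x` transfers finiteness to
  -- the integral itself.
  refine lt_top_iff_ne_top.2 fun htop => ?_
  rw [htop, ENNReal.mul_top (by simpa using hGpos k (by omega) x)] at h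
  exact lt_irrefl _ h

theorem snell_eq_max {k : ℕ} (hk : k < n) (x : E k) :
    snell f G M n k x = max (f k x) (G k x * ∫ y, snell f G M n (k + 1) y ∂(M k x)) := by
  unfold snell
  rw [show n - k = n - (k + 1) + 1 by omega, snellSteps]

omit [∀ k, MeasurableSpace (E k)] in
theorem snellHat_eq_max (z : ∀ m, Fin N → E m) {k : ℕ} (hk : k < n) (x : E k) :
    snellHat f G H z n k x = max (f k x) (empMean (z (k + 1))
      (fun y => meshWeight G H k (z k) x y * snellHat f G H z n (k + 1) y)) := by
  unfold snellHat
  rw [show n - k = n - (k + 1) + 1 by omega, snellHatSteps]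

/-! ### Decomposition of the error along the paths of the particles -/

/-- The positions at time `k + j` of the weighted particle system started from `x` at time `k`. -/
def pathPos (z : ∀ m, Fin N → E m) (k : ℕ) (x : E k) : ∀ j, Fin N → E (k + j)
  | 0 => fun _ => x
  | j + 1 => z (k + j + 1)

/-- The weights at time `k + j` of the weighted particle system started from `x` at time `k`: they
represent the composition of the empirical operators `Q̂_{k+1} ⋯ Q̂_{k+j}` at `x`. -/
noncomputable def pathWeight (G : ∀ k, E k → ℝ) (H : ∀ k, E k → E (k + 1) → ℝ)
    (z : ∀ m, Fin N → E m) (k : ℕ) (x : E k) : ℕ → Fin N → ℝ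
  | 0 => fun _ => (N : ℝ)⁻¹
  | j + 1 => fun i => ∑ i', pathWeight G H z k x j i' *
      (meshWeight G H (k + j) (z (k + j)) (pathPos z k x j i') (z (k + j + 1) i) / N)

/-- The difference `(Q̂_{l+1} - Q_{l+1}) (v)` at `x`, where `Q̂_{l+1}` is built from the particles
`z` and `u` at times `l` and `l + 1`. -/
noncomputable def fluctuation (G : ∀ k, E k → ℝ) (M : ∀ k, Kernel (E k) (E (k + 1)))
    (H : ∀ k, E k → E (k + 1) → ℝ) (l : ℕ) (v : E (l + 1) → ℝ) (z : Fin N → E l) (x : E l)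
    (u : Fin N → E (l + 1)) : ℝ :=
  empMean u (fun y => meshWeight G H l z x y * v y) - G l x * ∫ y, v y ∂(M l x)

theorem IsDensityModel.pathWeight_nonneg (hm : IsDensityModel n G M ν H ε)
    (z : ∀ m, Fin N → E m) (k : ℕ) (x : E k) (j : ℕ) (hj : k + j ≤ n) (i : Fin N) :
    0 ≤ pathWeight G H z k x j i := by
  induction j generalizing i with
  | zero => simp [pathWeight]
  | succ j ih =>
    refine Finset.sum_nonneg fun i' _ => mul_nonneg (ih (by omega) i') (div_nonneg ?_ ?_)
    · exact meshWeight_nonneg (hm.potential_pos _ (by omega)) (hm.density_pos _ (by omega)) _ _ _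
    · positivity

theorem IsDensityModel.abs_snellHat_sub_snell_le (hm : IsDensityModel n G M ν H ε)
    (z : ∀ m, Fin N → E m) {l : ℕ} (hl : l < n) (x : E l) :
    |snellHat f G H z n l x - snell f G M n l x| ≤
      |fluctuation G M H l (snell f G M n (l + 1)) (z l) x (z (l + 1))| +
        ∑ i, meshWeight G H l (z l) x (z (l + 1) i) / N *
          |snellHat f G H z n (l + 1) (z (l + 1) i) - snell f G M n (l + 1) (z (l + 1) i)| := by
  rw [snellHat_eq_max z hl, snell_eq_max hl]
  have h1 : empMean (z (l + 1)) (fun y => meshWeight G H l (z l) x y * snellHat f G H z n (l + 1) y)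
      - G l x * ∫ y, snell f G M n (l + 1) y ∂(M l x) =
      fluctuation G M H l (snell f G M n (l + 1)) (z l) x (z (l + 1)) +
        ∑ i, meshWeight G H l (z l) x (z (l + 1) i) / N *
          (snellHat f G H z n (l + 1) (z (l + 1) i) - snell f G M n (l + 1) (z (l + 1) i)) := by
    unfold fluctuation empMean
    simp only [mul_sub, Finset.sum_sub_distrib, Finset.sum_div]
    simp only [div_mul_eq_mul_div]
    ring
  have h2 := abs_max_sub_max_le_abs (empMean (z (l + 1))
    (fun y => meshWeight G H l (z l) x y * snellHat f G H z n (l + 1) y))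
    (G l x * ∫ y, snell f G M n (l + 1) y ∂(M l x)) (f l x)
  rw [h1, max_comm _ (f l x), max_comm _ (f l x)] at h2
  refine h2.trans ((abs_add_le _ _).trans ?_)
  gcongr
  refine (Finset.abs_sum_le_sum_abs _ _).trans (Finset.sum_le_sum fun i _ => ?_)
  rw [abs_mul, abs_of_nonneg]
  exact div_nonneg (meshWeight_nonneg (hm.potential_pos l hl) (hm.density_pos l hl) _ _ _)
    (Nat.cast_nonneg _)

/-- Iterates the one-step bound `L` times from `x`; the last sum is the remainder, which vanishes
when `k + L = n`. -/
theorem IsDensityModel.abs_snellHat_sub_snell_le_sum (hm : IsDensityModel n G M ν H ε)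
    (hN : 1 ≤ N) (z : ∀ m, Fin N → E m) (k : ℕ) (x : E k) (L : ℕ) (hL : k + L ≤ n) :
    |snellHat f G H z n k x - snell f G M n k x| ≤
      ∑ j ∈ Finset.range L, ∑ i, pathWeight G H z k x j i *
        |fluctuation G M H (k + j) (snell f G M n (k + j + 1)) (z (k + j)) (pathPos z k x j i)
          (z (k + j + 1))| +
      ∑ i, pathWeight G H z k x L i * |snellHat f G H z n (k + L) (pathPos z k x L i) -
        snell f G M n (k + L) (pathPos z k x L i)| := by
  induction L with
  | zero =>
    have : (N : ℝ) ≠ 0 := by exact_mod_cast (by omega : N ≠ 0)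
    simp [pathWeight, pathPos, this]
  | succ L ih =>
    refine (ih (by omega)).trans ?_
    rw [Finset.sum_range_succ, add_assoc]
    refine add_le_add_right ?_ _
    have h : ∀ i, pathWeight G H z k x L i *
        |snellHat f G H z n (k + L) (pathPos z k x L i) -
          snell f G M n (k + L) (pathPos z k x L i)| ≤ _ := fun i =>
      mul_le_mul_of_nonneg_left (hm.abs_snellHat_sub_snell_le z (by omega) (pathPos z k x L i))
        (hm.pathWeight_nonneg z k x L (by omega) i)
    refine (Finset.sum_le_sum fun i _ => h i).trans_eq ?_
    simp only [mul_add, Finset.sum_add_distrib]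
    congr 1
    simp only [Finset.mul_sum, pathWeight, Finset.sum_mul]
    rw [Finset.sum_comm]
    refine Finset.sum_congr rfl fun i _ => Finset.sum_congr rfl fun i' _ => ?_
    rw [mul_assoc]
    rfl

/-! ### Bounds and measurability of the path weights -/

theorem IsDensityModel.ofReal_pathWeight_succ (hm : IsDensityModel n G M ν H ε) (hN : 1 ≤ N)
    (z : ∀ m, Fin N → E m) (k : ℕ) (x : E k) (j : ℕ) (hj : k + j < n) (i : Fin N) :
    ENNReal.ofReal (pathWeight G H z k x (j + 1) i) =
      ∑ i', ENNReal.ofReal (pathWeight G H z k x j i') *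
        (ENNReal.ofReal (meshWeight G H (k + j) (z (k + j)) (pathPos z k x j i')
          (z (k + j + 1) i)) * (N : ℝ≥0∞)⁻¹) := by
  have hN' : (0 : ℝ) < N := by exact_mod_cast hN
  have hW := meshWeight_nonneg (N := N) (hm.potential_pos _ hj) (hm.density_pos _ hj)
  rw [pathWeight, ENNReal.ofReal_sum_of_nonneg fun i' _ =>
    mul_nonneg (hm.pathWeight_nonneg z k x j hj.le i') (div_nonneg (hW _ _ _) hN'.le)]
  refine Finset.sum_congr rfl fun i' _ => ?_
  rw [ENNReal.ofReal_mul (hm.pathWeight_nonneg z k x j hj.le i'), ENNReal.ofReal_div_of_pos hN',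
    ENNReal.ofReal_natCast, div_eq_mul_inv]

/-- The first step starts from the arbitrary point `x` and pays `‖h_{k+1}‖`. Later steps start from
all the particles, and `mean_meshWeight` makes each cost only `‖G_m‖`. -/
theorem IsDensityModel.ofReal_pathWeight_succ_le (hm : IsDensityModel n G M ν H ε) (hN : 1 ≤ N)
    (z : ∀ m, Fin N → E m) (k : ℕ) (x : E k) (j : ℕ) (hj : k + j < n) (i : Fin N) :
    ENNReal.ofReal (pathWeight G H z k x (j + 1) i) ≤
      supNormH H (k + 1) * (∏ m ∈ Finset.Ico k (k + j + 1), supNormG G m) * (N : ℝ≥0∞)⁻¹ := by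
  have hN' : (0 : ℝ) < N := by exact_mod_cast hN
  have hN0 : (N : ℝ≥0∞) ≠ 0 := by exact_mod_cast (by omega : N ≠ 0)
  have hGle : ∀ l < n, ∀ y, ENNReal.ofReal (G l y) ≤ supNormG G l := fun l hl y =>
    le_iSup_of_le y (by rw [abs_of_pos (hm.potential_pos l hl y)])
  induction j generalizing i with
  | zero =>
    rw [hm.ofReal_pathWeight_succ hN z k x 0 hj]
    simp only [pathWeight, pathPos, Finset.sum_const, Finset.card_univ, Fintype.card_fin,
      nsmul_eq_mul, add_zero, Nat.Ico_succ_singleton, Finset.prod_singleton]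
    rw [ENNReal.ofReal_inv_of_pos hN', ENNReal.ofReal_natCast, ← mul_assoc,
      ENNReal.mul_inv_cancel hN0 (by finiteness), one_mul]
    gcongr
    refine (ofReal_meshWeight_le hN (hm.potential_pos k hj) (hm.density_pos k hj) _ _ _).trans ?_
    rw [mul_comm]
    exact mul_le_mul' (le_iSup (hRatio H (k + 1)) _) (hGle k hj x)
  | succ j ih =>
    rw [hm.ofReal_pathWeight_succ hN z k x (j + 1) hj]
    have hW := meshWeight_nonneg (N := N) (hm.potential_pos _ hj) (hm.density_pos _ hj)
    set C := supNormH H (k + 1) * ∏ m ∈ Finset.Ico k (k + j + 1), supNormG G m with hC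
    calc _ ≤ ∑ i', C * (N : ℝ≥0∞)⁻¹ * (ENNReal.ofReal (meshWeight G H (k + (j + 1))
          (z (k + (j + 1))) (pathPos z k x (j + 1) i') (z (k + (j + 1) + 1) i)) *
            (N : ℝ≥0∞)⁻¹) := by
          gcongr with i'
          exact ih (by omega) i'
      _ = C * (N : ℝ≥0∞)⁻¹ * ENNReal.ofReal (empMean (z (k + (j + 1))) (G (k + (j + 1)))) := by
          rw [← Finset.mul_sum, ← Finset.sum_mul,
            ← mean_meshWeight hN (hm.potential_pos _ hj) (hm.density_pos _ hj) _
              (z (k + (j + 1) + 1) i), empMean, ENNReal.ofReal_div_of_pos hN',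
            ENNReal.ofReal_natCast, ENNReal.ofReal_sum_of_nonneg fun i' _ => hW _ _ _,
            div_eq_mul_inv]
          rfl
      _ ≤ C * (N : ℝ≥0∞)⁻¹ * supNormG G (k + (j + 1)) := by
          gcongr
          rw [empMean, ENNReal.ofReal_div_of_pos hN', ENNReal.ofReal_natCast,
            ENNReal.ofReal_sum_of_nonneg fun i' _ => (hm.potential_pos _ hj _).le]
          refine ENNReal.div_le_of_le_mul ?_
          refine (Finset.sum_le_sum fun i' _ => hGle _ hj _).trans_eq ?_
          simp [mul_comm]
      _ = _ := by
          rw [hC, Finset.prod_Ico_succ_top (by omega : k ≤ k + (j + 1))]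
          ring_nf

omit [∀ k, MeasurableSpace (E k)] in
theorem one_le_supNormH {k : ℕ} (hH : ∀ x y, 0 < H k x y) (x : E k) (y : E (k + 1)) :
    1 ≤ supNormH H (k + 1) := by
  refine le_iSup_of_le y (le_iSup₂_of_le x x ?_)
  rw [div_self (hH x y).ne', ENNReal.ofReal_one]

theorem IsDensityModel.sum_ofReal_pathWeight_le (hm : IsDensityModel n G M ν H ε) (hN : 1 ≤ N)
    (z : ∀ m, Fin N → E m) (k : ℕ) (x : E k) (j : ℕ) (hj : k + j < n) :
    ∑ i, ENNReal.ofReal (pathWeight G H z k x j i) ≤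
      supNormH H (k + 1) * ∏ m ∈ Finset.Ico k (k + j), supNormG G m := by
  have hN' : (0 : ℝ) < N := by exact_mod_cast hN
  have hN0 : (N : ℝ≥0∞) ≠ 0 := by exact_mod_cast (by omega : N ≠ 0)
  rcases j with _ | j
  · simp only [pathWeight, Finset.sum_const, Finset.card_univ, Fintype.card_fin, nsmul_eq_mul,
      add_zero, Finset.Ico_self, Finset.prod_empty, mul_one]
    rw [ENNReal.ofReal_inv_of_pos hN', ENNReal.ofReal_natCast,
      ENNReal.mul_inv_cancel hN0 (by finiteness)]
    -- With no step taken the mass is 1; any particle at time `k + 1` witnesses that the supremum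
    -- `‖h_{k+1}‖` is over a nonempty set.
    exact one_le_supNormH (hm.density_pos k hj) x (z (k + 1) ⟨0, hN⟩)
  · refine (Finset.sum_le_sum fun i _ =>
      hm.ofReal_pathWeight_succ_le hN z k x j (by omega) i).trans_eq ?_
    simp only [Finset.sum_const, Finset.card_univ, Fintype.card_fin, nsmul_eq_mul]
    rw [mul_comm, mul_assoc, ENNReal.inv_mul_cancel hN0 (by finiteness), mul_one]
    rfl

theorem measurable_pathPos {γ : Type*} [MeasurableSpace γ] {ζ : ∀ m, γ → Fin N → E m} {k : ℕ}
    (x : E k) {j : ℕ} (hζ : ∀ m ≤ k + j, Measurable (ζ m)) :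
    Measurable fun c => pathPos (fun m => ζ m c) k x j := by
  rcases j with _ | j
  · exact measurable_const
  · exact hζ _ le_rfl

theorem IsDensityModel.measurable_pathWeight (hm : IsDensityModel n G M ν H ε) {γ : Type*}
    [MeasurableSpace γ] {ζ : ∀ m, γ → Fin N → E m} {k : ℕ} (x : E k) {j : ℕ} (hj : k + j ≤ n)
    (hζ : ∀ m ≤ k + j, Measurable (ζ m)) (i : Fin N) :
    Measurable fun c => pathWeight G H (fun m => ζ m c) k x j i := by
  induction j generalizing i with
  | zero => exact measurable_const
  | succ j ih =>
    refine Finset.measurable_fun_sum _ fun i' _ => (ih (by omega) (fun m hm => hζ m (by omega))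
      i').mul ((measurable_meshWeight (hm.measurable_potential _ (by omega))
        (hm.measurable_density _ (by omega)) (hζ _ (by omega)) ?_ ?_).div_const _)
    · exact (measurable_pi_apply i').comp (measurable_pathPos x fun m hm => hζ m (by omega))
    · exact (measurable_pi_apply i).comp (hζ _ le_rfl)

theorem IsDensityModel.measurable_fluctuation (hm : IsDensityModel n G M ν H ε)
    {l : ℕ} (hl : l < n) {v : E (l + 1) → ℝ} (hv : Measurable v) {γ : Type*} [MeasurableSpace γ]
    {z : γ → Fin N → E l} {x : γ → E l} {u : γ → Fin N → E (l + 1)} (hz : Measurable z)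
    (hx : Measurable x) (hu : Measurable u) :
    Measurable fun c => fluctuation G M H l v (z c) (x c) (u c) := by
  refine (measurable_empMean hu ?_).sub (((hm.measurable_potential l hl).comp hx).mul
    (hv.stronglyMeasurable.integral_kernel.measurable.comp hx))
  exact (measurable_meshWeight (hm.measurable_potential l hl) (hm.measurable_density l hl)
    (hz.comp measurable_fst) (hx.comp measurable_fst) measurable_snd).mul (hv.comp measurable_snd)

end Model

/-! ### Unbiasedness of the path weights and moments of the path-weighted fluctuations -/

section Moments

variable {E : ℕ → Type*} [∀ k, MeasurableSpace (E k)] {f G : ∀ k, E k → ℝ}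
  {M : ∀ k, Kernel (E k) (E (k + 1))} [∀ k, IsMarkovKernel (M k)]
  {ν : ∀ k, Measure (E (k + 1))} {H : ∀ k, E k → E (k + 1) → ℝ} {ε : ℝ} {n N : ℕ}
  {Ω : Type*} [mΩ : MeasurableSpace Ω] {P : Measure Ω} [IsProbabilityMeasure P]
  {η₀ : Measure (E 0)} {ξ : ∀ k, Ω → Fin N → E k}

omit [∀ k, IsMarkovKernel (M k)] in
theorem IsDensityModel.measurable_path (hm : IsDensityModel n G M ν H ε) {γ : Type*}
    [mγ : MeasurableSpace γ] {ζ : ∀ m, γ → Fin N → E m} {k : ℕ} (x : E k) {j : ℕ}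
    (hj : k + j ≤ n) (hζ : ∀ m ≤ k + j, Measurable (ζ m)) :
    Measurable fun c => (fun i => ENNReal.ofReal (pathWeight G H (fun m => ζ m c) k x j i),
      pathPos (fun m => ζ m c) k x j, ζ (k + j) c) :=
  (measurable_pi_iff.2 fun i => (hm.measurable_pathWeight x hj hζ i).ennreal_ofReal).prodMk
    ((measurable_pathPos x hζ).prodMk (hζ _ le_rfl))

omit mΩ [∀ k, IsMarkovKernel (M k)] in
theorem IsDensityModel.measurable_pastSigma_path (hm : IsDensityModel n G M ν H ε) (k : ℕ)
    (x : E k) (j : ℕ) (hj : k + j ≤ n) :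
    Measurable[pastSigma ξ (k + j)] fun ω =>
      (fun i => ENNReal.ofReal (pathWeight G H (fun m => ξ m ω) k x j i),
        pathPos (fun m => ξ m ω) k x j, ξ (k + j) ω) :=
  hm.measurable_path (mγ := pastSigma ξ (k + j)) x hj fun _ hm => measurable_pastSigma hm

/-- The weighted particle system started from `x` is unbiased. -/
theorem IsDensityModel.lintegral_sum_pathWeight (hm : IsDensityModel n G M ν H ε) (hN : 1 ≤ N)
    (hξ : IsParticleModel η₀ M G ε n P ξ) (k : ℕ) (x : E k) (j : ℕ) (hj : k + j ≤ n)
    {g : ∀ m, E m → ℝ≥0∞} (hg : Measurable (g (k + j))) :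
    ∫⁻ ω, ∑ i, ENNReal.ofReal (pathWeight G H (fun m => ξ m ω) k x j i) *
        g (k + j) (pathPos (fun m => ξ m ω) k x j i) ∂P = QSteps G M g j k x := by
  have hN' : (0 : ℝ) < N := by exact_mod_cast hN
  have hN0 : (N : ℝ≥0∞) ≠ 0 := by exact_mod_cast (by omega : N ≠ 0)
  induction j generalizing g with
  | zero =>
    simp only [pathWeight, pathPos, Finset.sum_const, Finset.card_univ, Fintype.card_fin,
      nsmul_eq_mul, lintegral_const, measure_univ, mul_one]
    rw [ENNReal.ofReal_inv_of_pos hN', ENNReal.ofReal_natCast, ← mul_assoc,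
      ENNReal.mul_inv_cancel hN0 (by finiteness), one_mul]
    rfl
  | succ j ih =>
    have hl : k + j < n := hj
    have hg : Measurable (g (k + j + 1)) := hg
    have hgm := hm.measurable_potential _ hl
    have hgp := hm.potential_pos _ hl
    have hdm := hm.measurable_density _ hl
    have hdp := hm.density_pos _ hl
    have heG := hm.mul_potential_le_one _ hl
    -- It remains to integrate out the last generation, conditionally on the past.
    rw [QSteps_succ_eq, ← ih (by omega) (hm.measurable_QStep hl hg.aemeasurable)]
    set Ψ : ((Fin N → ℝ≥0∞) × (Fin N → E (k + j)) × (Fin N → E (k + j))) ×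
        (Fin N → E (k + j + 1)) → ℝ≥0∞ := fun c => ∑ i', c.1.1 i' * ((N : ℝ≥0∞)⁻¹ *
          ∑ i, ENNReal.ofReal (meshWeight G H (k + j) c.1.2.2 (c.1.2.1 i') (c.2 i)) *
            g (k + j + 1) (c.2 i)) with hΨ
    have hterm : ∀ {γ : Type _} [MeasurableSpace γ] {z : γ → Fin N → E (k + j)}
        {y : γ → E (k + j)} {u : γ → E (k + j + 1)}, Measurable z → Measurable y → Measurable u →
        Measurable fun c => ENNReal.ofReal (meshWeight G H (k + j) (z c) (y c) (u c)) *
          g (k + j + 1) (u c) := fun hz hy hu =>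
      (measurable_meshWeight hgm hdm hz hy hu).ennreal_ofReal.mul (hg.comp hu)
    have hΨm : Measurable Ψ := by
      refine Finset.measurable_fun_sum _ fun i' _ => Measurable.mul (by fun_prop)
        (Measurable.const_mul (Finset.measurable_fun_sum _ fun i _ => ?_) _)
      exact hterm (by fun_prop) (by fun_prop) (by fun_prop)
    have h := hξ.lintegral_step hN hm.nonneg hl hgm hgp heG
      (hm.measurable_pastSigma_path k x j hl.le) hΨm
    calc _ = ∫⁻ ω, Ψ ((fun i => ENNReal.ofReal (pathWeight G H (fun m => ξ m ω) k x j i),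
            pathPos (fun m => ξ m ω) k x j, ξ (k + j) ω), ξ (k + j + 1) ω) ∂P := by
          refine lintegral_congr fun ω => ?_
          simp only [hm.ofReal_pathWeight_succ hN _ k x j hl, hΨ, Finset.sum_mul, Finset.mul_sum]
          rw [Finset.sum_comm]
          refine Finset.sum_congr rfl fun i' _ => Finset.sum_congr rfl fun i _ => ?_
          simp only [pathPos]
          change _ * g (k + j + 1) _ = _
          ring
      _ = _ := h
      _ = _ := by
          refine lintegral_congr fun ω => ?_
          have := isProbabilityMeasure_selectionLaw_bind hN hm.nonneg hgp heG (M (k + j))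
            (ξ (k + j) ω)
          have hterm' : ∀ y, Measurable fun u : E (k + j + 1) =>
              ENNReal.ofReal (meshWeight G H (k + j) (ξ (k + j) ω) y u) * g (k + j + 1) u :=
            fun y => hterm measurable_const measurable_const measurable_id
          have hterm'' : ∀ y i, Measurable fun u : Fin N → E (k + j + 1) =>
              ENNReal.ofReal (meshWeight G H (k + j) (ξ (k + j) ω) y (u i)) *
                g (k + j + 1) (u i) :=
            fun y i => (hterm' y).comp (measurable_pi_apply i)
          simp only [hΨ]
          rw [lintegral_finsetSum _ fun i' _ => ((Finset.measurable_fun_sum _ fun i _ =>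
            hterm'' _ i).const_mul _).const_mul _]
          refine Finset.sum_congr rfl fun i' _ => ?_
          rw [lintegral_const_mul _ ((Finset.measurable_fun_sum _ fun i _ =>
              hterm'' _ i).const_mul _),
            lintegral_const_mul _ (Finset.measurable_fun_sum _ fun i _ => hterm'' _ i),
            lintegral_finsetSum _ fun i _ => hterm'' _ i]
          congr 1
          have hmarg : ∀ y i, ∫⁻ u, ENNReal.ofReal (meshWeight G H (k + j) (ξ (k + j) ω) y (u i)) *
                g (k + j + 1) (u i) ∂(particleStep ε (G (k + j)) (M (k + j)) (ξ (k + j) ω)) =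
              ∫⁻ u, ENNReal.ofReal (meshWeight G H (k + j) (ξ (k + j) ω) y u) *
                g (k + j + 1) u ∂((selectionLaw ε (G (k + j)) (ξ (k + j) ω) i).bind
                  (M (k + j))) := fun y i =>
            (measurePreserving_eval (fun i => (selectionLaw ε (G (k + j)) (ξ (k + j) ω) i).bind
              (M (k + j))) i).lintegral_comp (hterm' y)
          simp only [hmarg]
          rw [sum_lintegral_meshWeight_mul hN hgm hgp hdm hdp (hm.eq_withDensity _ hl) hm.nonneg
            heG _ _ hg, ← mul_assoc, ENNReal.inv_mul_cancel hN0 (by finiteness), one_mul]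
          rfl

/-- Jensen for weights of arbitrary total mass. It makes the `p`-th powers of the fluctuations enter
linearly, so conditional moments can be taken term by term. -/
theorem sum_mul_pow_le {ι : Type*} (s : Finset ι) (w a : ι → ℝ≥0∞) {p : ℕ} (hp : 1 ≤ p) :
    (∑ i ∈ s, w i * a i) ^ p ≤ (∑ i ∈ s, w i) ^ (p - 1) * ∑ i ∈ s, w i * a i ^ p := by
  have hp0 : (0 : ℝ) < p := by exact_mod_cast hp
  have h := ENNReal.inner_le_weight_mul_Lp_of_nonneg s (p := p) (by exact_mod_cast hp) w a
  simp only [ENNReal.rpow_natCast] at h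
  calc _ ≤ ((∑ i ∈ s, w i) ^ (1 - (p : ℝ)⁻¹) * (∑ i ∈ s, w i * a i ^ p) ^ (p : ℝ)⁻¹) ^ p := by
        gcongr
    _ = _ := by
        rw [mul_pow, ← ENNReal.rpow_natCast, ← ENNReal.rpow_mul,
          ← ENNReal.rpow_natCast (_ ^ (p : ℝ)⁻¹), ← ENNReal.rpow_mul, inv_mul_cancel₀ hp0.ne',
          ENNReal.rpow_one, sub_mul, inv_mul_cancel₀ hp0.ne', ← ENNReal.rpow_natCast (∑ i ∈ s, w i)]
        congr 2
        push_cast [Nat.cast_sub hp]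
        ring

/-- The concave counterpart: it moves the exponent `r = p / p'` outside the weighted sum, where
unbiasedness can be used. -/
theorem sum_mul_rpow_le {ι : Type*} (s : Finset ι) (w b : ι → ℝ≥0∞) {r : ℝ} (hr0 : 0 < r)
    (hr : r ≤ 1) :
    ∑ i ∈ s, w i * b i ^ r ≤ (∑ i ∈ s, w i) ^ (1 - r) * (∑ i ∈ s, w i * b i) ^ r := by
  have h := ENNReal.inner_le_weight_mul_Lp_of_nonneg s (p := r⁻¹) (one_le_inv₀ hr0 |>.2 hr) w
    (fun i => b i ^ r)
  simpa only [inv_inv, ← ENNReal.rpow_mul, mul_inv_cancel₀ hr0.ne', ENNReal.rpow_one] using h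

theorem lintegral_rpow_le_rpow_lintegral {α : Type*} [MeasurableSpace α] {μ : Measure α}
    [IsProbabilityMeasure μ] {g : α → ℝ≥0∞} (hg : Measurable g) {r : ℝ} (hr0 : 0 < r)
    (hr : r ≤ 1) : ∫⁻ a, g a ^ r ∂μ ≤ (∫⁻ a, g a ∂μ) ^ r := by
  have h := lintegral_rpow_le_lintegral_rpow (μ := μ) (hg.pow_const r) (one_le_inv₀ hr0 |>.2 hr)
  simp only [← ENNReal.rpow_mul, mul_inv_cancel₀ hr0.ne', ENNReal.rpow_one] at h
  calc _ = ((∫⁻ a, g a ^ r ∂μ) ^ r⁻¹) ^ r := by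
        rw [← ENNReal.rpow_mul, inv_mul_cancel₀ hr0.ne', ENNReal.rpow_one]
    _ ≤ _ := by gcongr

/-- The moments of the fluctuation at time `k + j`, weighted along the particle paths. -/
theorem IsDensityModel.lintegral_sum_pathWeight_fluctuation_pow_le
    (hm : IsDensityModel n G M ν H ε) (hN : 1 ≤ N) (hξ : IsParticleModel η₀ M G ε n P ξ) (k : ℕ)
    (x : E k) (j : ℕ) (hj : k + j < n) {v : ∀ m, E m → ℝ} (hv : Measurable (v (k + j + 1)))
    (hvi : ∀ y, Integrable (v (k + j + 1)) (M (k + j) y))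
    (hh : AEMeasurable (hRatio H (k + j + 1)) (ν (k + j)))
    {p p' : ℕ} (hp : 1 ≤ p) (hp' : Even p') (hpp' : p ≤ p') :
    ∫⁻ ω, (∑ i, ENNReal.ofReal (pathWeight G H (fun m => ξ m ω) k x j i) *
        ‖fluctuation G M H (k + j) (v (k + j + 1)) (ξ (k + j) ω)
          (pathPos (fun m => ξ m ω) k x j i) (ξ (k + j + 1) ω)‖ₑ) ^ p ∂P ≤
      ENNReal.ofReal (2 * aConst p / Real.sqrt N) ^ p *
        ((supNormH H (k + 1) * ∏ m ∈ Finset.Ico k (k + j), supNormG G m) ^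
            ((p : ℝ) - (p : ℝ) / p') *
          (supNormG G (k + j) ^ (p' - 1) * QSteps G M (fun m y => hRatio H m y ^ (p' - 1) *
            ENNReal.ofReal (v m y ^ p')) (j + 1) k x) ^ ((p : ℝ) / p')) := by
  have hp0 : (0 : ℝ) < p := by exact_mod_cast hp
  have hp'0 : (0 : ℝ) < p' := by exact_mod_cast hp.trans hpp'
  have hr0 : 0 < (p : ℝ) / p' := by positivity
  have hr1 : (p : ℝ) / p' ≤ 1 := by rw [div_le_one hp'0]; exact_mod_cast hpp'
  have hgm := hm.measurable_potential _ hj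
  have hgp := hm.potential_pos _ hj
  have hdm := hm.measurable_density _ hj
  have hdp := hm.density_pos _ hj
  have heG := hm.mul_potential_le_one _ hj
  set g : ∀ m, E m → ℝ≥0∞ := fun m y => hRatio H m y ^ (p' - 1) * ENNReal.ofReal (v m y ^ p')
    with hg
  set c := ENNReal.ofReal (2 * aConst p / Real.sqrt N) with hc
  set C := supNormH H (k + 1) * ∏ m ∈ Finset.Ico k (k + j), supNormG G m with hC
  set A : Ω → Fin N → ℝ≥0∞ :=
    fun ω i => ENNReal.ofReal (pathWeight G H (fun m => ξ m ω) k x j i) with hA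
  set Y : Ω → Fin N → E (k + j) := fun ω => pathPos (fun m => ξ m ω) k x j with hY
  set b : E (k + j) → ℝ≥0∞ := fun y => supNormG G (k + j) ^ (p' - 1) * QStep G M g (k + j) y
    with hb
  have hQm : Measurable (QStep G M g (k + j)) := hm.measurable_QStep hj
    ((hh.pow_const _).mul (hv.pow_const _).ennreal_ofReal.aemeasurable)
  have hpath := (hm.measurable_pastSigma_path (ξ := ξ) k x j hj.le)
  have hpath' := hpath.mono (pastSigma_le hξ.measurable hj.le) le_rfl
  have hAm : Measurable A := measurable_fst.comp hpath'
  have hYm : Measurable Y := (measurable_fst.comp measurable_snd).comp hpath'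
  set Ψ : ((Fin N → ℝ≥0∞) × (Fin N → E (k + j)) × (Fin N → E (k + j))) ×
      (Fin N → E (k + j + 1)) → ℝ≥0∞ := fun q => (∑ i, q.1.1 i) ^ (p - 1) * ∑ i, q.1.1 i *
        ‖fluctuation G M H (k + j) (v (k + j + 1)) q.1.2.2 (q.1.2.1 i) q.2‖ₑ ^ p with hΨ
  have hΨm : Measurable Ψ := by
    refine Measurable.mul (by fun_prop) (Finset.measurable_fun_sum _ fun i _ =>
      Measurable.mul (by fun_prop) (Measurable.pow_const (Measurable.enorm ?_) _))
    exact hm.measurable_fluctuation hj hv (by fun_prop) (by fun_prop) (by fun_prop)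
  have hcond : ∀ ω, ∫⁻ u, Ψ ((A ω, Y ω, ξ (k + j) ω), u)
      ∂(particleStep ε (G (k + j)) (M (k + j)) (ξ (k + j) ω)) ≤
      c ^ p * (C ^ ((p : ℝ) - (p : ℝ) / p') * (∑ i, A ω i * b (Y ω i)) ^ ((p : ℝ) / p')) := by
    intro ω
    have hfm : ∀ y, Measurable fun u =>
        ‖fluctuation G M H (k + j) (v (k + j + 1)) (ξ (k + j) ω) y u‖ₑ ^ p := fun y =>
      (hm.measurable_fluctuation hj hv measurable_const measurable_const
        measurable_id).enorm.pow_const _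
    simp only [hΨ]
    rw [lintegral_const_mul _ (Finset.measurable_fun_sum _ fun i _ => (hfm _).const_mul _),
      lintegral_finsetSum _ fun i _ => (hfm _).const_mul _]
    simp only [lintegral_const_mul _ (hfm _)]
    calc _ ≤ (∑ i, A ω i) ^ (p - 1) * ∑ i, A ω i * (c ^ p * b (Y ω i) ^ ((p : ℝ) / p')) := by
          gcongr with i
          exact lintegral_particleStep_fluctuation_le hN hgm hgp hdm hdp
            (hm.eq_withDensity _ hj) hm.nonneg heG _ _ hv (hvi _) hp hp' hpp'
      _ = c ^ p * ((∑ i, A ω i) ^ (p - 1) * ∑ i, A ω i * b (Y ω i) ^ ((p : ℝ) / p')) := by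
          simp_rw [mul_left_comm (A ω _), ← Finset.mul_sum]
          ring
      _ ≤ c ^ p * ((∑ i, A ω i) ^ (p - 1) * ((∑ i, A ω i) ^ (1 - (p : ℝ) / p') *
            (∑ i, A ω i * b (Y ω i)) ^ ((p : ℝ) / p'))) := by
          gcongr
          exact sum_mul_rpow_le _ _ _ hr0 hr1
      -- The two Jensen steps give the mass the exponent `(p - 1) + (1 - p / p') = p - p / p'`.
      _ = c ^ p * ((∑ i, A ω i) ^ ((p : ℝ) - (p : ℝ) / p') *
            (∑ i, A ω i * b (Y ω i)) ^ ((p : ℝ) / p')) := by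
          rw [← mul_assoc ((∑ i, A ω i) ^ (p - 1)), ← ENNReal.rpow_natCast _ (p - 1),
            ← ENNReal.rpow_add_of_nonneg _ _ (Nat.cast_nonneg _) (by linarith)]
          congr 3
          push_cast [Nat.cast_sub hp]
          ring
      _ ≤ _ := by
          gcongr
          · have : (1 : ℝ) ≤ p := by exact_mod_cast hp
            linarith
          · exact hm.sum_ofReal_pathWeight_le hN _ k x j hj
  have hsum : Measurable fun ω => ∑ i, A ω i * b (Y ω i) :=
    Finset.measurable_fun_sum _ fun i _ => ((measurable_pi_apply i).comp hAm).mul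
      ((hQm.const_mul _).comp ((measurable_pi_apply i).comp hYm))
  have hQsum : Measurable fun ω => ∑ i, A ω i * QStep G M g (k + j) (Y ω i) :=
    Finset.measurable_fun_sum _ fun i _ => ((measurable_pi_apply i).comp hAm).mul
      (hQm.comp ((measurable_pi_apply i).comp hYm))
  have hE : ∫⁻ ω, ∑ i, A ω i * QStep G M g (k + j) (Y ω i) ∂P =
      QSteps G M (QStep G M g) j k x := hm.lintegral_sum_pathWeight hN hξ k x j hj.le hQm
  calc _ ≤ ∫⁻ ω, Ψ ((A ω, Y ω, ξ (k + j) ω), ξ (k + j + 1) ω) ∂P :=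
        lintegral_mono fun ω => sum_mul_pow_le _ _ _ hp
    _ = ∫⁻ ω, ∫⁻ u, Ψ ((A ω, Y ω, ξ (k + j) ω), u)
          ∂(particleStep ε (G (k + j)) (M (k + j)) (ξ (k + j) ω)) ∂P :=
        hξ.lintegral_step hN hm.nonneg hj hgm hgp heG hpath hΨm
    _ ≤ ∫⁻ ω, c ^ p * (C ^ ((p : ℝ) - (p : ℝ) / p') *
          (∑ i, A ω i * b (Y ω i)) ^ ((p : ℝ) / p')) ∂P := lintegral_mono hcond
    _ = c ^ p * (C ^ ((p : ℝ) - (p : ℝ) / p') *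
          ∫⁻ ω, (∑ i, A ω i * b (Y ω i)) ^ ((p : ℝ) / p') ∂P) := by
        rw [lintegral_const_mul _ ((hsum.pow_const _).const_mul _),
          lintegral_const_mul _ (hsum.pow_const _)]
    _ ≤ c ^ p * (C ^ ((p : ℝ) - (p : ℝ) / p') *
          (∫⁻ ω, ∑ i, A ω i * b (Y ω i) ∂P) ^ ((p : ℝ) / p')) := by
        gcongr
        exact lintegral_rpow_le_rpow_lintegral hsum hr0 hr1
    _ = _ := by
        congr 3
        rw [QSteps_succ_eq, ← hE, ← lintegral_const_mul _ hQsum]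
        refine lintegral_congr fun ω => ?_
        rw [Finset.mul_sum]
        exact Finset.sum_congr rfl fun i _ => mul_left_comm _ _ _

/-- After the `p`-th root, the mass bound `C` and the norm `S` of `G_l` carry the same exponent `(p'
- 1) / p'`, hence merge into `qConst`. -/
theorem rpow_moment_bound (c C S D : ℝ≥0∞) {p p' : ℕ} (hp : 1 ≤ p) (hp' : 1 ≤ p') :
    (c ^ p * (C ^ ((p : ℝ) - (p : ℝ) / p') * (S ^ (p' - 1) * D) ^ ((p : ℝ) / p'))) ^
        (1 / (p : ℝ)) = c * (S * C) ^ (((p' : ℝ) - 1) / p') * D ^ (1 / (p' : ℝ)) := by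
  have hp0 : (0 : ℝ) < p := by exact_mod_cast hp
  have hp1 : (1 : ℝ) ≤ p' := by exact_mod_cast hp'
  have hp'0 : (0 : ℝ) < p' := by linarith
  have e1 : ((p : ℝ) - p / p') * (1 / p) = ((p' : ℝ) - 1) / p' := by field_simp
  have e2 : (p : ℝ) / p' * (1 / p) = 1 / p' := by field_simp
  have e3 : 0 ≤ ((p' : ℝ) - 1) / p' := div_nonneg (by linarith) hp'0.le
  rw [ENNReal.mul_rpow_of_nonneg _ _ (by positivity),
    ENNReal.mul_rpow_of_nonneg _ _ (by positivity), ← ENNReal.rpow_natCast c, ← ENNReal.rpow_mul,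
    ← ENNReal.rpow_mul, ← ENNReal.rpow_mul, mul_one_div_cancel hp0.ne', ENNReal.rpow_one, e1, e2,
    ENNReal.mul_rpow_of_nonneg _ _ (by positivity), ENNReal.mul_rpow_of_nonneg _ _ e3,
    ← ENNReal.rpow_natCast S, ← ENNReal.rpow_mul, Nat.cast_sub hp', Nat.cast_one, mul_one_div]
  ring

theorem IsDensityModel.eLpNorm_sum_pathWeight_fluctuation_le
    (hm : IsDensityModel n G M ν H ε) (hN : 1 ≤ N) (hξ : IsParticleModel η₀ M G ε n P ξ) (k : ℕ)
    (x : E k) (j : ℕ) (hj : k + j < n) {v : ∀ m, E m → ℝ} (hv : Measurable (v (k + j + 1)))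
    (hvi : ∀ y, Integrable (v (k + j + 1)) (M (k + j) y))
    (hh : AEMeasurable (hRatio H (k + j + 1)) (ν (k + j)))
    {p p' : ℕ} (hp : 1 ≤ p) (hp' : Even p') (hpp' : p ≤ p') :
    eLpNorm (fun ω => ∑ i, pathWeight G H (fun m => ξ m ω) k x j i *
        |fluctuation G M H (k + j) (v (k + j + 1)) (ξ (k + j) ω)
          (pathPos (fun m => ξ m ω) k x j i) (ξ (k + j + 1) ω)|) p P ≤
      ENNReal.ofReal (2 * aConst p / Real.sqrt N) * qConst G H p' k (k + j) *
        (Qop G M k (k + j + 1) (fun m y => hRatio H m y ^ (p' - 1) *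
          ENNReal.ofReal (v m y ^ p')) x) ^ (1 / (p' : ℝ)) := by
  have hp0 : (0 : ℝ) < p := by exact_mod_cast hp
  have h := hm.lintegral_sum_pathWeight_fluctuation_pow_le hN hξ k x j hj hv hvi hh hp hp' hpp'
  rw [eLpNorm_eq_lintegral_rpow_enorm_toReal (by exact_mod_cast (by omega : p ≠ 0))
    (by finiteness)]
  simp only [ENNReal.toReal_natCast, ENNReal.rpow_natCast]
  have hen : ∀ ω, ‖∑ i, pathWeight G H (fun m => ξ m ω) k x j i *
        |fluctuation G M H (k + j) (v (k + j + 1)) (ξ (k + j) ω)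
          (pathPos (fun m => ξ m ω) k x j i) (ξ (k + j + 1) ω)|‖ₑ =
      ∑ i, ENNReal.ofReal (pathWeight G H (fun m => ξ m ω) k x j i) *
        ‖fluctuation G M H (k + j) (v (k + j + 1)) (ξ (k + j) ω)
          (pathPos (fun m => ξ m ω) k x j i) (ξ (k + j + 1) ω)‖ₑ := by
    intro ω
    have hw := hm.pathWeight_nonneg (fun m => ξ m ω) k x j hj.le
    rw [Real.enorm_of_nonneg (Finset.sum_nonneg fun i _ => mul_nonneg (hw i) (abs_nonneg _)),
      ENNReal.ofReal_sum_of_nonneg fun i _ => mul_nonneg (hw i) (abs_nonneg _)]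
    refine Finset.sum_congr rfl fun i _ => ?_
    rw [ENNReal.ofReal_mul (hw i), Real.enorm_eq_ofReal_abs]
  simp only [hen]
  refine (ENNReal.rpow_le_rpow h (by positivity)).trans_eq ?_
  rw [Qop, show k + j + 1 - k = j + 1 by omega, qConst, mul_assoc (supNormG G (k + j))]
  exact rpow_moment_bound _ _ _ _ hp (hp.trans hpp')

end Moments

/-! ### The error bound for the Snell envelope -/

theorem mainTheorem1 {E : ℕ → Type*} [∀ k, MeasurableSpace (E k)]
    {Ω : Type*} [MeasurableSpace Ω] (P : Measure Ω) [IsProbabilityMeasure P]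
    (n N : ℕ) (hN : 1 ≤ N)
    (η₀ : Measure (E 0)) [IsProbabilityMeasure η₀]
    (M : ∀ k, Kernel (E k) (E (k + 1))) [∀ k, IsMarkovKernel (M k)]
    (f G : ∀ k, E k → ℝ)
    (hf : ∀ k ≤ n, Measurable (f k))
    (hG : ∀ k < n, Measurable (G k))
    (hGpos : ∀ k < n, ∀ x, 0 < G k x)
    -- the transitions have positive densities `H` with respect to reference measures `ν`
    (ν : ∀ k, Measure (E (k + 1))) (H : ∀ k, E k → E (k + 1) → ℝ)
    (hH : ∀ k < n, Measurable (Function.uncurry (H k)))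
    (hHpos : ∀ k < n, ∀ x y, 0 < H k x y)
    (hM : ∀ k < n, ∀ x, M k x = (ν k).withDensity (fun y => ENNReal.ofReal (H k x y)))
    (hh : ∀ k < n, AEMeasurable (hRatio H (k + 1)) (ν k))
    -- the gain functions are integrable, so that the Snell envelope is well defined
    (hint : ∀ k l, k ≤ l → l ≤ n → ∀ x,
      Qop G M k l (fun m y => ENNReal.ofReal |f m y|) x < ∞)
    -- the selection parameter
    (ε : ℝ) (hε : 0 ≤ ε) (hεG : ∀ k < n, ∀ x, ε * G k x ≤ 1)
    (ξ : ∀ k, Ω → Fin N → E k) (hξ : IsParticleModel η₀ M G ε n P ξ)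
    (p p' : ℕ) (hp : 1 ≤ p) (hp' : Even p') (hpp' : p ≤ p')
    (k : ℕ) (hk : k ≤ n) :
    (∀ x : E k,
      eLpNorm (fun ω => snellHat f G H (fun m => ξ m ω) n k x - snell f G M n k x) p P
        ≤ errorBound f G M H n N p p' k x) ∧
    (⨆ x : E k,
      eLpNorm (fun ω => snellHat f G H (fun m => ξ m ω) n k x - snell f G M n k x) p P)
        ≤ ⨆ x : E k, errorBound f G M H n N p p' k x := by
  have hm : IsDensityModel n G M ν H ε := ⟨hG, hGpos, hH, hHpos, hM, hε, hεG⟩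
  suffices hpt : ∀ x : E k,
      eLpNorm (fun ω => snellHat f G H (fun m => ξ m ω) n k x - snell f G M n k x) p P
        ≤ errorBound f G M H n N p p' k x from ⟨hpt, iSup_mono hpt⟩
  intro x
  obtain ⟨L, rfl⟩ := Nat.exists_eq_add_of_le hk
  have hsm : ∀ j < L, Measurable (snell f G M (k + L) (k + j + 1)) := fun j hj =>
    measurable_snellSteps hf hG _ _ (by omega)
  set T : ℕ → Ω → ℝ := fun j ω => ∑ i, pathWeight G H (fun m => ξ m ω) k x j i *
    |fluctuation G M H (k + j) (snell f G M (k + L) (k + j + 1)) (ξ (k + j) ω)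
      (pathPos (fun m => ξ m ω) k x j i) (ξ (k + j + 1) ω)| with hT
  have hTm : ∀ j ∈ Finset.range L, AEStronglyMeasurable (T j) P := by
    intro j hj
    have hj := Finset.mem_range.1 hj
    have hζ : ∀ m ≤ k + j, Measurable (ξ m) := fun m hm => hξ.measurable m (by omega)
    refine (Finset.measurable_fun_sum _ fun i _ => (hm.measurable_pathWeight x (by omega) hζ i).mul
      (Measurable.abs ?_)).aestronglyMeasurable
    exact hm.measurable_fluctuation (by omega) (hsm j hj) (hζ _ le_rfl)
      ((measurable_pi_apply i).comp (measurable_pathPos x hζ)) (hξ.measurable _ (by omega))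
  have hle : ∀ ω, ‖snellHat f G H (fun m => ξ m ω) (k + L) k x - snell f G M (k + L) k x‖ ≤
      (∑ j ∈ Finset.range L, T j) ω := by
    intro ω
    have h := hm.abs_snellHat_sub_snell_le_sum (f := f) hN (fun m => ξ m ω) k x L le_rfl
    -- At the horizon both envelopes equal `f`, so the remainder of the iterated bound is zero.
    have hend : ∀ y : E (k + L), snellHat f G H (fun m => ξ m ω) (k + L) (k + L) y -
        snell f G M (k + L) (k + L) y = 0 := fun y => by
      simp [snellHat, snell, snellHatSteps, snellSteps]
    simpa [hend, hT] using h
  calc _ ≤ eLpNorm (∑ j ∈ Finset.range L, T j) p P := eLpNorm_mono_real hle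
    _ ≤ ∑ j ∈ Finset.range L, eLpNorm (T j) p P := eLpNorm_sum_le hTm (by exact_mod_cast hp)
    _ ≤ _ := by
      rw [errorBound, Finset.sum_Ico_eq_sum_range, Nat.add_sub_cancel_left]
      refine Finset.sum_le_sum fun j hj => ?_
      have hj := Finset.mem_range.1 hj
      exact hm.eLpNorm_sum_pathWeight_fluctuation_le hN hξ k x j (by omega)
        (v := snell f G M (k + L)) (hsm j hj)
        (fun y => integrable_snellSteps hf hG hGpos hint _ _ (by omega) y)
        (hh _ (by omega)) hp hp' hpp'
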